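/- Conventions. A metrizable space $X$ is an ANR if, whenever it is embedded as a closed subset of a metrizable space $M$, it is a retract of an open neighbourhood in $M$. $\dim$ is covering dimension. A map is proper if preimages of compact sets are compact. All maps are continuous, and neighbourhoods are open. $k$-equivalence steps. Let $F:U\to U'$ be a map, and let $V\subset U$, $V'\subset U'$ be open with $F(V)\subset V'$. Call $(V,V')$ a $k$-step for $F$ if for all $0\le i\le k$: (injectivity) every $\alpha:S^i\to V$ with $F\alpha$ null-homotopic in $V'$ is null-homotopic in $U$; (surjectivity) for every $\beta:S^i\to V'$ there is $\alpha:S^i\to U$ with $F\alpha\simeq\beta$ in $U'$, and if $\beta(s)=F(x)$ for some $s\in S^i$, $x\in V$, then one can also choose such an $\alpha$ with $\alpha(s)=x$ and the homotopy rel $s$. $k$-shape equivalences. A map $f:A\to B$ of compact metrizable spaces is a $k$-shape equivalence if $A$ and $B$ have finitely many components and $f$ induces isomorphisms of the inverse systems of homotopy groups through dimension $k$ (at all base points, and including the sets of components). Explicitly: for all embeddings $A\subset L$, $B\subset M$ into ANRs, all neighbourhoods $U_A$ of $A$ in $L$ and $U_B$ of $B$ in $M$, and every map $F:U_A\to U_B$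 extending $f$, there are neighbourhoods $V_A\subset U_A$ of $A$ and $V_B\subset U_B$ of $B$ such that $(V_A,V_B)$ is a $k$-step for $F$. Let $f:X\to Y$ and $p:Y\to Z$ be maps. (a) $f$ is a $k$-shape equivalence over $Z$ if for each $z\in Z$ the restriction $f^{-1}(p^{-1}(z))\to p^{-1}(z)$ is a $k$-shape equivalence. (b) $f$ is a $k$-shape equivalence near the fibres over $Z$ if for each $z\in Z$ and each neighbourhood $W$ of $z$ there is a neighbourhood $W'\subset W$ of $z$ such that $(f^{-1}p^{-1}(W'),\,p^{-1}(W'))$ is a $k$-step for $f:f^{-1}p^{-1}(W)\to p^{-1}(W)$. Theorem. Let $X,Y$ be locally compact metrizable ANRs with $\dim X\le k$ and $\dim Y\le k$, let $f:X\to Y$ be a map, and let $p:Y\to Z$ be a proper surjection onto a metric space $Z$. (1) Suppose $f$ is proper and is a $k$-shape equivalence over $Z$ in the sense of (a). Then $f$ is a proper homotopy equivalence. Moreover, for every continuous $\epsilon:Z\to(0,\infty)$ there are a proper map $g:Y\to X$ and proper homotopies $H:fg\simeq\mathrm{id}_Y$ and $K:gf\simeq\mathrm{id}_X$ such that, for all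 $t\in[0,1]$, $y\in Y$, $x\in X$, $$d(pH_t(y),p(y))<\epsilon(p(y)),\qquad d(pfK_t(x),pf(x))<\epsilon(pf(x)).$$ (2) Suppose $f$, not necessarily proper, is a $k$-shape equivalence near the fibres over $Z$ in the sense of (b). Then $f$ is a homotopy equivalence. Moreover, for every continuous $\epsilon:Z\to(0,\infty)$ there are a map $g:Y\to X$ and homotopies $H:fg\simeq\mathrm{id}_Y$ and $K:gf\simeq\mathrm{id}_X$ satisfying the same two inequalities. -/

import Mathlib

open Set Topology unitInterval

universe u v w

/-- `X` is an absolute neighbourhood retract (for metrizable spaces): `X` is metrizable and, whenever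
`X` is embedded as a closed subset of a metrizable space `M`, it is a retract of an open
neighbourhood in `M`. -/
def IsANR (X : Type u) [TopologicalSpace X] : Prop :=
  TopologicalSpace.MetrizableSpace X ∧
    ∀ (M : Type u) [TopologicalSpace M] [TopologicalSpace.MetrizableSpace M] (e : X → M),
      IsClosedEmbedding e →
        ∃ (U : Set M) (_ : IsOpen U) (hU : ∀ x, e x ∈ U) (r : C(U, X)), ∀ x, r ⟨e x, hU x⟩ = x

/-- Covering dimension at most `n`: every open cover has an open refinement such that each point
lies in at most `n + 1` of its members. -/
def CoveringDimLE (n : ℕ) (X : Type u) [TopologicalSpace X] : Prop :=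
  ∀ 𝒰 : Set (Set X), (∀ U ∈ 𝒰, IsOpen U) → ⋃₀ 𝒰 = univ →
    ∃ 𝒱 : Set (Set X), (∀ V ∈ 𝒱, IsOpen V) ∧ ⋃₀ 𝒱 = univ ∧ (∀ V ∈ 𝒱, ∃ U ∈ 𝒰, V ⊆ U) ∧
      ∀ x, {V ∈ 𝒱 | x ∈ V}.encard ≤ n + 1

/-- The unit sphere `S^i` in Euclidean `(i + 1)`-space; `S^0` consists of two points. -/
abbrev Sph (i : ℕ) : Type := Metric.sphere (0 : EuclideanSpace ℝ (Fin (i + 1))) 1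

/-- The map `α` is homotopic to a constant map by a homotopy inside the subset `V`. -/
def NullIn {S : Type u} {B : Type v} [TopologicalSpace S] [TopologicalSpace B] (V : Set B)
    (α : C(S, B)) : Prop :=
  ∃ (b : B) (H : α.Homotopy (ContinuousMap.const S b)), ∀ q, H q ∈ V

/-- One step of the assertion that `F : U → U'` is an isomorphism of homotopy groups through
dimension `k` in the limit over shrinking neighbourhoods; `V ⊆ U` and `V' ⊆ U'` are smaller
neighbourhoods with `F V ⊆ V'`. For every `i ≤ k`:
* injectivity: a map `α : S^i → V` whose image `F α` is null-homotopic in `V'` is null-homotopic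
  in `U` (for `i = 0`: two points of `V` whose images are joined in `V'` are joined in `U`);
* surjectivity: every `β : S^i → V'` is homotopic in `U'` to `F α` for some `α : S^i → U`;
* surjectivity with base points: if moreover `β s = F x` with `x ∈ V`, then `α` can be chosen
  with `α s = x` and the homotopy relative to `s`. -/
structure IsKEquivStep (k : ℕ) {U : Type u} {U' : Type v} [TopologicalSpace U]
    [TopologicalSpace U'] (F : C(U, U')) (V : Set U) (V' : Set U') : Prop where
  mapsTo : MapsTo F V V'
  injective : ∀ i ≤ k, ∀ α : C(Sph i, U), (∀ s, α s ∈ V) → NullIn V' (F.comp α) → NullIn univ α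
  surjective : ∀ i ≤ k, ∀ β : C(Sph i, U'), (∀ s, β s ∈ V') →
    ∃ α : C(Sph i, U), (F.comp α).Homotopic β
  surjective_based : ∀ i ≤ k, ∀ β : C(Sph i, U'), (∀ s, β s ∈ V') →
    ∀ s : Sph i, ∀ x ∈ V, β s = F x →
      ∃ α : C(Sph i, U), α s = x ∧ (F.comp α).HomotopicRel β {s}

/-- A map `f : A → B` of compact metrizable spaces is a `k`-shape equivalence: `A` and `B` have
finitely many components, and `f` induces isomorphisms of the (inverse systems of) homotopy groups
through dimension `k`, at all base points and including the sets of components. In primitive form: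
embed `A` and `B` into ANRs `L` and `M`, and let `F : UA → UB` be a map of open neighbourhoods
extending `f`; then there are smaller neighbourhoods `VA`, `VB` as in `IsKEquivStep`. -/
def IsKShapeEquiv (k : ℕ) {A : Type u} {B : Type v} [TopologicalSpace A] [TopologicalSpace B]
    (f : A → B) : Prop :=
  Finite (ConnectedComponents A) ∧ Finite (ConnectedComponents B) ∧
    ∀ (L : Type u) [TopologicalSpace L] (M : Type v) [TopologicalSpace M],
      IsANR L → IsANR M →
      ∀ (a : A → L) (b : B → M), IsEmbedding a → IsEmbedding b →
      ∀ (UA : Set L) (UB : Set M), IsOpen UA → IsOpen UB →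
      ∀ (hA : ∀ x, a x ∈ UA) (hB : ∀ y, b y ∈ UB) (F : C(UA, UB)),
        (∀ x, F ⟨a x, hA x⟩ = ⟨b (f x), hB (f x)⟩) →
        ∃ (VA : Set UA) (VB : Set UB), IsOpen VA ∧ IsOpen VB ∧
          (∀ x, (⟨a x, hA x⟩ : UA) ∈ VA) ∧ (∀ y, (⟨b y, hB y⟩ : UB) ∈ VB) ∧
          IsKEquivStep k F VA VB

section Over

variable {X : Type u} {Y : Type v} {Z : Type w}
  [TopologicalSpace X] [TopologicalSpace Y] [TopologicalSpace Z]

/-- The restriction `f⁻¹(p⁻¹(W)) → p⁻¹(W)` of `f`. -/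
def restrictOver (f : C(X, Y)) (p : C(Y, Z)) (W : Set Z) :
    C(f ⁻¹' (p ⁻¹' W), p ⁻¹' W) where
  toFun x := ⟨f x.1, x.2⟩

/-- `f : X → Y` is a `k`-shape equivalence over `Z` with respect to `p : Y → Z`: for each `z`,
the restriction `f⁻¹(p⁻¹(z)) → p⁻¹(z)` is a `k`-shape equivalence. -/
def IsKShapeEquivOver (k : ℕ) (f : C(X, Y)) (p : C(Y, Z)) : Prop :=
  ∀ z : Z, IsKShapeEquiv k (restrictOver f p {z})

/-- The version of `IsKShapeEquivOver` for a map `f` of ANRs that need not be proper (its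
point-inverses over `Z` may then be non-compact, and their neighbourhoods need not contain
preimages of neighbourhoods in `Z`): the ANRs around the point-inverses are `X` and `Y`
themselves, the extension is `f`, and only neighbourhoods pulled back from `Z` are used. -/
def IsKShapeEquivNear (k : ℕ) (f : C(X, Y)) (p : C(Y, Z)) : Prop :=
  ∀ (z : Z) (W : Set Z), IsOpen W → z ∈ W →
    ∃ W' : Set Z, IsOpen W' ∧ z ∈ W' ∧ W' ⊆ W ∧
      IsKEquivStep k (restrictOver f p W) {x | p (f x) ∈ W'} {y | p y ∈ W'}

end Over

/-- `f` is a proper homotopy equivalence. -/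
def IsProperHomotopyEquiv {X : Type u} {Y : Type v} [TopologicalSpace X] [TopologicalSpace Y]
    (f : C(X, Y)) : Prop :=
  IsProperMap f ∧ ∃ g : C(Y, X), IsProperMap g ∧
    (∃ H : (f.comp g).Homotopy (ContinuousMap.id Y), IsProperMap H) ∧
    (∃ K : (g.comp f).Homotopy (ContinuousMap.id X), IsProperMap K)

/-- A homotopy `H` from a self-map of `Y` to the identity is `(q, ε)`-small, for `q : Y → Z`: the
`q`-image of the track of each point `y` stays within `ε (q y)` of `q y`. -/
def IsSmallHomotopy {Y : Type v} {Z : Type w} [TopologicalSpace Y] [MetricSpace Z]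
    (q : C(Y, Z)) (ε : C(Z, ℝ)) {h : C(Y, Y)} (H : h.Homotopy (ContinuousMap.id Y)) : Prop :=
  ∀ (t : I) (y : Y), dist (q (H (t, y))) (q y) < ε (q y)

/-! This is a controlled Whitehead theorem. Over small sets of $Z$, and after shrinking, $f$ is
surjective and injective on homotopy groups through degree $k$. Surjectivity lets a map of an
$n$-cell into $Y$ with $n\le k$ be lifted to $X$ up to a small homotopy extending one given on the
boundary. Injectivity in degree $k$ still extends the lift over $(k+1)$-cells, but without a
homotopy. `IsBallStep.exists_lift` and `IsBallStep.exists_fill` are these two statements for one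
ball; `IsLiftChain.exists_isLiftOver` assembles them, skeleton by skeleton, over prisms
$\Delta\times J$ on the simplices of a complex.

A locally compact ANR of dimension at most $k$ is, up to a small homotopy, a retract of the nerve of
a fine cover of order at most $k+1$ (`IsANR.exists_domination`): embed it isometrically in a normed
space, map the nerve linearly, and retract. Lifting the map from the nerve to $Y$ yields $g$ with
$fg\simeq\mathrm{id}$ (`exists_right_inverse`). For the other composite, $H$ evaluated along $f$ is
a homotopy $fgf\simeq f$. Pulled back to the nerve of $X$, it is a map of nerve $\times I$ into $Y$
whose ends are lifted by $gf$ and $\mathrm{id}$. These prisms have dimension at most $k+1$, so a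
lift relative to the ends exists, and it is a homotopy $gf\simeq\mathrm{id}$
(`exists_left_homotopy`). No homotopy in $Y$ is needed on the top prisms, which is why isomorphisms
through degree $k$ suffice.

Control is measured by gauges, positive $1$-Lipschitz functions on $Z$, since no uniform constant is
available when $Z$ is not compact. One dimension of lifting costs two shrinkings, and there are only
$k+1$ dimensions, so a finite part of a chain of gauges suffices.

In the proper case the maps are closed, so neighbourhoods of fibres contain preimages of
neighbourhoods of points and hypothesis (a) implies (b) (`IsKShapeEquivOver.near`). Moreover $Z$ is
then locally compact, and a map sufficiently close over $Z$ to a proper map is proper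
(`isProperMap_of_close`). -/

/-- A continuous function on a subset extends to a function continuous on that subset. -/
theorem exists_continuousOn_extension {A : Type*} {T : Type*} [TopologicalSpace A]
    [TopologicalSpace T] [Nonempty T] {s : Set A} (g : s → T) (hg : Continuous g) :
    ∃ G : A → T, ContinuousOn G s ∧ ∀ x : s, G x = g x := by
  classical
  refine ⟨fun x => if h : x ∈ s then g ⟨x, h⟩ else Classical.arbitrary T, ?_, fun x => by simp⟩
  rw [continuousOn_iff_continuous_domRestrict]
  convert hg using 1
  ext x
  simp

/-! ### Gauges: variable scales on a metric space -/

/-- Positive functions that are `1`-Lipschitz. -/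
def IsGauge {Z : Type*} [PseudoMetricSpace Z] (δ : Z → ℝ) : Prop :=
  (∀ z, 0 < δ z) ∧ ∀ z w, δ z ≤ δ w + dist z w

/-- A property that holds locally uniformly at small scales holds at the scale of a gauge. -/
theorem exists_gauge {Z : Type*} [PseudoMetricSpace Z] (Q : Z → ℝ → Prop)
    (hQ : ∀ z r s, 0 < s → s ≤ r → Q z r → Q z s)
    (hloc : ∀ z, ∃ r > 0, ∀ w, dist w z < r → Q w r) :
    ∃ δ : Z → ℝ, IsGauge δ ∧ ∀ z, Q z (δ z) := by
  let S : Z → Set ℝ := fun z => {r | r ≤ 1 ∧ ∀ w, dist w z < r → Q w r}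
  have hb : ∀ z, BddAbove (S z) := fun z => ⟨1, fun r hr => hr.1⟩
  have hpos : ∀ z, 0 < sSup (S z) := by
    intro z
    obtain ⟨r, hr, h⟩ := hloc z
    have : min r 1 ∈ S z := ⟨min_le_right _ _, fun w hw =>
      hQ w r _ (lt_min hr one_pos) (min_le_left _ _) (h w (hw.trans_le (min_le_left _ _)))⟩
    exact (lt_min hr one_pos).trans_le (le_csSup (hb z) this)
  have hne : ∀ z, (S z).Nonempty := by
    intro z
    by_contra h
    have := hpos z
    rw [not_nonempty_iff_eq_empty.1 h, Real.sSup_empty] at this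
    exact lt_irrefl _ this
  have hlip : ∀ z w, sSup (S z) ≤ sSup (S w) + dist z w := by
    intro z w
    refine csSup_le (hne z) fun r hr => ?_
    rcases le_or_gt r (dist z w) with h | h
    · linarith [hpos w]
    -- The ball of radius `r - dist z w` about `w` lies in the `r`-ball about `z`; this is the
    -- source of the Lipschitz constant 1.
    have : r - dist z w ∈ S w := by
      refine ⟨by linarith [hr.1, dist_nonneg (x := z) (y := w)], fun q hq => ?_⟩
      refine hQ q r _ (by linarith) (by linarith [dist_nonneg (x := z) (y := w)]) (hr.2 q ?_)
      have := dist_triangle q w z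
      rw [dist_comm w z] at this
      linarith
    linarith [le_csSup (hb w) this]
  -- The supremum need not belong to `S z`, but half of it is exceeded by a member.
  refine ⟨fun z => sSup (S z) / 2, ⟨fun z => half_pos (hpos z), fun z w => ?_⟩, fun z => ?_⟩
  · have := hlip z w
    have := dist_nonneg (x := z) (y := w)
    simp only
    linarith
  · obtain ⟨r, hr, h⟩ := exists_lt_of_lt_csSup (hne z) (half_lt_self (hpos z))
    exact hQ z r _ (half_pos (hpos z)) h.le (hr.2 z (by simpa using (half_pos (hpos z)).trans h))

theorem IsGauge.div {Z : Type*} [PseudoMetricSpace Z] {δ : Z → ℝ} (h : IsGauge δ) {c : ℝ}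
    (hc : 1 ≤ c) : IsGauge fun z => δ z / c := by
  have hc0 : 0 < c := by linarith
  refine ⟨fun z => div_pos (h.1 z) hc0, fun z w => ?_⟩
  simp only
  rw [div_add' _ _ _ hc0.ne', div_le_div_iff_of_pos_right hc0]
  nlinarith [h.2 z w, dist_nonneg (x := z) (y := w)]

theorem exists_gauge_le {Z : Type*} [PseudoMetricSpace Z] {ε : Z → ℝ} (hc : Continuous ε)
    (hε : ∀ z, 0 < ε z) : ∃ δ : Z → ℝ, IsGauge δ ∧ ∀ z, δ z ≤ ε z := by
  refine exists_gauge (fun z r => r ≤ ε z) (fun z r s _ h h' => h.trans h') fun z => ?_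
  have := hc.continuousAt (x := z) |>.eventually (lt_mem_nhds (half_lt_self (hε z)))
  obtain ⟨r, hr, h⟩ := Metric.eventually_nhds_iff.1 this
  exact ⟨min r (ε z / 2), lt_min hr (half_pos (hε z)), fun w hw =>
    (min_le_right _ _).trans (h (hw.trans_le (min_le_left _ _))).le⟩

theorem IsGauge.min {Z : Type*} [PseudoMetricSpace Z] {δ η : Z → ℝ} (h : IsGauge δ)
    (h' : IsGauge η) : IsGauge fun z => min (δ z) (η z) := by
  refine ⟨fun z => lt_min (h.1 z) (h'.1 z), fun z w => ?_⟩
  simp only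
  rw [← min_add_add_right]
  exact min_le_min (h.2 z w) (h'.2 z w)

/-! ### Balls and spheres as quotients -/

/-- Euclidean space of dimension `n`. -/
abbrev Euc (n : ℕ) : Type := EuclideanSpace ℝ (Fin n)

/-- The closed unit ball of Euclidean space. -/
abbrev uball (n : ℕ) : Set (Euc n) := Metric.closedBall 0 1

/-- The unit sphere of Euclidean space. -/
abbrev usphere (n : ℕ) : Set (Euc n) := Metric.sphere 0 1

theorem norm_of_mem_usphere {n : ℕ} {v : Euc n} (h : v ∈ usphere n) : ‖v‖ = 1 := by simpa using h

theorem norm_le_of_mem_uball {n : ℕ} {v : Euc n} (h : v ∈ uball n) : ‖v‖ ≤ 1 := by simpa using h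

theorem usphere_subset_uball (n : ℕ) : usphere n ⊆ uball n := Metric.sphere_subset_closedBall

instance instNonemptySph (n : ℕ) : Nonempty (Sph n) :=
  (NormedSpace.sphere_nonempty.2 zero_le_one).to_subtype

/-- The ball is the cone of the sphere: `(t, s) ↦ (1 - t) s`. -/
noncomputable def coneMap (n : ℕ) (q : I × Sph n) : uball (n + 1) :=
  ⟨(1 - (q.1 : ℝ)) • (q.2 : Euc (n + 1)), by
    have h1 := norm_of_mem_usphere q.2.2
    have h2 := q.1.2.1
    have h3 := q.1.2.2
    simp only [Metric.mem_closedBall, dist_zero_right, norm_smul, h1, Real.norm_eq_abs, mul_one]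
    rw [abs_le]; constructor <;> linarith⟩

/-- A continuous surjection from a compact space to a Hausdorff one. It makes a null-homotopy of a
map of the sphere descend to an extension over the ball. -/
theorem isQuotientMap_coneMap (n : ℕ) : IsQuotientMap (coneMap n) := by
  have hc : Continuous (coneMap n) := by unfold coneMap; fun_prop
  refine hc.isClosedMap.isQuotientMap hc ?_
  rintro ⟨v, hv⟩
  have hv' := norm_le_of_mem_uball hv
  by_cases h : v = 0
  · obtain ⟨s⟩ : Nonempty (Sph n) := inferInstance
    exact ⟨(1, s), Subtype.ext (by simp [coneMap, h])⟩
  · have h0 : ‖v‖ ≠ 0 := norm_ne_zero_iff.2 h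
    refine ⟨(⟨1 - ‖v‖, by linarith, by linarith [norm_nonneg v]⟩, ⟨‖v‖⁻¹ • v, ?_⟩), ?_⟩
    · simp [norm_smul, h0]
    · simp [coneMap, smul_smul, h0]

/-- The map of the ball to the sphere that collapses the boundary sphere to a point. -/
noncomputable def collapse (n : ℕ) (v : uball n) : Sph n :=
  ⟨WithLp.toLp 2 (Fin.cons (2 * ‖(v : Euc n)‖ ^ 2 - 1)
      fun i => 2 * Real.sqrt (1 - ‖(v : Euc n)‖ ^ 2) * (v : Euc n) i), by
    have hv := norm_le_of_mem_uball v.2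
    have h0 : 0 ≤ 1 - ‖(v : Euc n)‖ ^ 2 := by nlinarith [norm_nonneg (v : Euc n)]
    have : ‖(v : Euc n)‖ ^ 2 = ∑ i, (v : Euc n) i ^ 2 := by
      rw [EuclideanSpace.norm_sq_eq]; simp
    rw [mem_sphere_zero_iff_norm, ← sq_eq_sq₀ (norm_nonneg _) zero_le_one,
      EuclideanSpace.norm_sq_eq, Fin.sum_univ_succ]
    simp only [Fin.cons_zero, Fin.cons_succ, Real.norm_eq_abs, sq_abs, mul_pow,
      Real.sq_sqrt h0, ← Finset.mul_sum, ← this]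
    ring⟩

theorem collapse_eq_of_norm {n : ℕ} {v v' : uball n} (h : ‖(v : Euc n)‖ = 1)
    (h' : ‖(v' : Euc n)‖ = 1) : collapse n v = collapse n v' := by
  apply Subtype.ext
  simp [collapse, h, h']

theorem eq_of_collapse_eq {n : ℕ} {v v' : uball n} (h : collapse n v = collapse n v') :
    v = v' ∨ ‖(v : Euc n)‖ = 1 ∧ ‖(v' : Euc n)‖ = 1 := by
  have hcoord : ∀ i : Fin (n + 1), (collapse n v : Euc (n + 1)) i = (collapse n v' : Euc (n + 1)) i :=
    fun i => by rw [h]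
  have h0 := hcoord 0
  simp only [collapse, Fin.cons_zero] at h0
  have hn : ‖(v : Euc n)‖ = ‖(v' : Euc n)‖ := by
    rw [← sq_eq_sq₀ (norm_nonneg _) (norm_nonneg _)]; linarith
  by_cases h1 : ‖(v : Euc n)‖ = 1
  · exact Or.inr ⟨h1, hn ▸ h1⟩
  left
  apply Subtype.ext
  ext i
  have hi := hcoord i.succ
  simp only [collapse, Fin.cons_succ, ← hn] at hi
  have hlt : ‖(v : Euc n)‖ < 1 := lt_of_le_of_ne (norm_le_of_mem_uball v.2) h1
  have : 0 < Real.sqrt (1 - ‖(v : Euc n)‖ ^ 2) := by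
    apply Real.sqrt_pos.2; nlinarith [norm_nonneg (v : Euc n)]
  exact mul_left_cancel₀ (by positivity) hi

theorem isQuotientMap_collapse (n : ℕ) (hn : 1 ≤ n) : IsQuotientMap (collapse n) := by
  have hc : Continuous (collapse n) := by
    unfold collapse
    refine Continuous.subtype_mk ((PiLp.continuous_toLp 2 _).comp ?_) _
    refine continuous_pi fun i => ?_
    refine Fin.cases ?_ (fun j => ?_) i
    · simp only [Fin.cons_zero]; fun_prop
    · simp only [Fin.cons_succ]; fun_prop
  refine hc.isClosedMap.isQuotientMap hc ?_
  rintro ⟨s, hs⟩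
  have hs1 := norm_of_mem_usphere hs
  have hsum : s 0 ^ 2 + ∑ i : Fin n, s i.succ ^ 2 = 1 := by
    have := EuclideanSpace.norm_sq_eq s
    rw [hs1, Fin.sum_univ_succ] at this
    simpa using this.symm
  have hnn : 0 ≤ ∑ i : Fin n, s i.succ ^ 2 := Finset.sum_nonneg fun i _ => sq_nonneg _
  by_cases h1 : s 0 = 1
  · have hz : ∀ i : Fin n, s i.succ = 0 := by
      intro i
      have h2 : ∑ i : Fin n, s i.succ ^ 2 = 0 := by rw [h1] at hsum; linarith
      have := (Finset.sum_eq_zero_iff_of_nonneg fun i _ => sq_nonneg _).1 h2 i (Finset.mem_univ i)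
      simpa using this
    -- The pole `s 0 = 1` is the image of the boundary sphere, which is empty for `n = 0`; there
    -- `collapse` is not surjective.
    obtain ⟨m, rfl⟩ : ∃ m, n = m + 1 := ⟨n - 1, by omega⟩
    obtain ⟨t⟩ : Nonempty (Sph m) := inferInstance
    refine ⟨⟨t, usphere_subset_uball _ t.2⟩, Subtype.ext ?_⟩
    ext i
    have ht := norm_of_mem_usphere t.2
    refine Fin.cases ?_ (fun j => ?_) i
    · simp only [collapse, Fin.cons_zero, ht, h1]; norm_num
    · simp [collapse, Fin.cons_succ, ht, hz]
  · have hlt : s 0 < 1 := by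
      rcases lt_or_gt_of_ne h1 with h | h
      · exact h
      · nlinarith
    have hge : -1 ≤ s 0 := by nlinarith
    -- Inverting `collapse` off the pole: the zeroth coordinate forces `‖v‖ ^ 2 = (1 + s 0) / 2`, so
    -- `c` is `√(1 - ‖v‖ ^ 2)`.
    set c := Real.sqrt ((1 - s 0) / 2) with hcdef
    have hcpos : 0 < c := Real.sqrt_pos.2 (by linarith)
    have hc2 : c ^ 2 = (1 - s 0) / 2 := Real.sq_sqrt (by linarith)
    let v : Euc n := WithLp.toLp 2 fun i => s i.succ / (2 * c)
    have hv2 : ‖v‖ ^ 2 = (1 + s 0) / 2 := by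
      rw [EuclideanSpace.norm_sq_eq]
      simp only [v, Real.norm_eq_abs, sq_abs, div_pow, ← Finset.sum_div, mul_pow, hc2]
      have : ∑ i : Fin n, s i.succ ^ 2 = (1 - s 0) * (1 + s 0) := by linarith
      rw [this]
      have : 1 - s 0 ≠ 0 := by linarith
      field_simp
    have hv : v ∈ uball n := by
      rw [mem_closedBall_zero_iff]
      nlinarith [norm_nonneg v]
    refine ⟨⟨v, hv⟩, Subtype.ext ?_⟩
    ext i
    refine Fin.cases ?_ (fun j => ?_) i
    · simp only [collapse, Fin.cons_zero, hv2]; ring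
    · simp only [collapse, Fin.cons_succ, hv2]
      have : 1 - (1 + s 0) / 2 = (1 - s 0) / 2 := by ring
      rw [this, ← hcdef]
      simp only [v]
      field_simp

/-! ### Homotopy group conditions as filling and lifting conditions on balls -/

section Step
variable {X : Type u} {Y : Type v} {Z : Type w}
  [TopologicalSpace X] [TopologicalSpace Y] [TopologicalSpace Z]

/-- A form of `IsKEquivStep` for subsets `W' ⊆ W` of `Z`, in terms of functions on closed balls. -/
structure IsBallStep (k : ℕ) (f : C(X, Y)) (p : C(Y, Z)) (W W' : Set Z) : Prop where
  vertex : ∀ y, p y ∈ W' → ∃ (x : X) (γ : ℝ → Y), ContinuousOn γ (Icc 0 1) ∧ γ 0 = f x ∧ γ 1 = y ∧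
    p (f x) ∈ W ∧ ∀ t ∈ Icc (0 : ℝ) 1, p (γ t) ∈ W
  fill : ∀ n ≤ k, ∀ (a : Euc (n + 1) → X) (b : Euc (n + 1) → Y), ContinuousOn a (usphere _) →
    ContinuousOn b (uball _) → (∀ v ∈ usphere _, b v = f (a v)) → (∀ v ∈ uball _, p (b v) ∈ W') →
    ∃ a' : Euc (n + 1) → X, ContinuousOn a' (uball _) ∧ (∀ v ∈ usphere _, a' v = a v) ∧
      ∀ v ∈ uball _, p (f (a' v)) ∈ W
  lift : ∀ n ≤ k, 1 ≤ n → ∀ (β : Euc n → Y) (x : X), ContinuousOn β (uball n) →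
    (∀ v ∈ usphere n, β v = f x) → (∀ v ∈ uball n, p (β v) ∈ W') →
    ∃ (α : Euc n → X) (Γ : Euc n × ℝ → Y), ContinuousOn α (uball n) ∧
      ContinuousOn Γ (uball n ×ˢ Icc 0 1) ∧ (∀ v ∈ usphere n, α v = x) ∧
      (∀ v ∈ uball n, Γ (v, 0) = f (α v)) ∧ (∀ v ∈ uball n, Γ (v, 1) = β v) ∧
      (∀ v ∈ usphere n, ∀ t ∈ Icc (0 : ℝ) 1, Γ (v, t) = f x) ∧
      (∀ v ∈ uball n, p (f (α v)) ∈ W) ∧ ∀ v ∈ uball n, ∀ t ∈ Icc (0 : ℝ) 1, p (Γ (v, t)) ∈ W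

theorem IsBallStep.mono {k : ℕ} {f : C(X, Y)} {p : C(Y, Z)} {W W' A A' : Set Z}
    (h : IsBallStep k f p W W') (hW : W ⊆ A) (hW' : A' ⊆ W') : IsBallStep k f p A A' where
  vertex y hy := by
    obtain ⟨x, γ, h1, h2, h3, h4, h5⟩ := h.vertex y (hW' hy)
    exact ⟨x, γ, h1, h2, h3, hW h4, fun t ht => hW (h5 t ht)⟩
  fill n hn a b ha hb hab hp := by
    obtain ⟨a', h1, h2, h3⟩ := h.fill n hn a b ha hb hab fun v hv => hW' (hp v hv)
    exact ⟨a', h1, h2, fun v hv => hW (h3 v hv)⟩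
  lift n hn hn' β x hβ hx hp := by
    obtain ⟨α, Γ, h1, h2, h3, h4, h5, h6, h7, h8⟩ := h.lift n hn hn' β x hβ hx
      fun v hv => hW' (hp v hv)
    exact ⟨α, Γ, h1, h2, h3, h4, h5, h6, fun v hv => hW (h7 v hv),
      fun v hv t ht => hW (h8 v hv t ht)⟩

variable {k : ℕ} {f : C(X, Y)} {p : C(Y, Z)} {W W' : Set Z}

/-- Surjectivity in degree 0, applied to a constant map of `S^0`; the track of one of its two points
is the path. -/
theorem exists_path_of_isKEquivStep (hW : W' ⊆ W)
    (h : IsKEquivStep k (restrictOver f p W) {x | p (f x) ∈ W'} {y | p y ∈ W'})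
    (y : Y) (hy : p y ∈ W') : ∃ (x : X) (γ : ℝ → Y), ContinuousOn γ (Icc 0 1) ∧ γ 0 = f x ∧
      γ 1 = y ∧ p (f x) ∈ W ∧ ∀ t ∈ Icc (0 : ℝ) 1, p (γ t) ∈ W := by
  obtain ⟨α, ⟨H⟩⟩ := h.surjective 0 (Nat.zero_le _) (ContinuousMap.const _ ⟨y, hW hy⟩)
    (fun _ => hy)
  obtain ⟨s⟩ : Nonempty (Sph 0) := inferInstance
  refine ⟨(α s).1, fun t => (H (projIcc 0 1 zero_le_one t, s)).1, ?_, ?_, ?_, (α s).2, ?_⟩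
  · have : Continuous fun t : ℝ => (H (projIcc 0 1 zero_le_one t, s)).1 := by
      have := continuous_projIcc (a := (0 : ℝ)) (b := 1) (h := zero_le_one)
      fun_prop
    exact this.continuousOn
  · have : projIcc (0 : ℝ) 1 zero_le_one 0 = 0 := projIcc_left _
    simp only [this]
    rw [H.apply_zero]; rfl
  · have : projIcc (0 : ℝ) 1 zero_le_one 1 = 1 := projIcc_right _
    simp only [this]
    rw [H.apply_one]; rfl
  · intro t _
    exact (H (projIcc 0 1 zero_le_one t, s)).2

/-- Since the ball is the cone on its boundary, `b` is a null-homotopy of `f ∘ a`, and a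
null-homotopy of `a` is an extension over the ball. Thus this is injectivity in degree `n`. -/
theorem exists_fill_of_isKEquivStep (hW : W' ⊆ W)
    (h : IsKEquivStep k (restrictOver f p W) {x | p (f x) ∈ W'} {y | p y ∈ W'})
    (n : ℕ) (hn : n ≤ k) (a : Euc (n + 1) → X) (b : Euc (n + 1) → Y)
    (ha : ContinuousOn a (usphere _)) (hb : ContinuousOn b (uball _))
    (hab : ∀ v ∈ usphere _, b v = f (a v)) (hp : ∀ v ∈ uball _, p (b v) ∈ W') :
    ∃ a' : Euc (n + 1) → X, ContinuousOn a' (uball _) ∧ (∀ v ∈ usphere _, a' v = a v) ∧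
      ∀ v ∈ uball _, p (f (a' v)) ∈ W := by
  have hpa : ∀ v ∈ usphere (n + 1), p (f (a v)) ∈ W' := fun v hv => by
    rw [← hab v hv]; exact hp v (usphere_subset_uball _ hv)
  let α : C(Sph n, f ⁻¹' (p ⁻¹' W)) :=
    ⟨fun s => ⟨a s, hW (hpa s s.2)⟩, by
      refine Continuous.subtype_mk ?_ _
      exact continuousOn_iff_continuous_domRestrict.1 ha⟩
  let Hf : I × Sph n → p ⁻¹' W := fun q => ⟨b (coneMap n q), hW (hp _ (coneMap n q).2)⟩
  have hHf : Continuous Hf := by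
    refine Continuous.subtype_mk ?_ _
    exact (continuousOn_iff_continuous_domRestrict.1 hb).comp (isQuotientMap_coneMap n).continuous
  have hb0 : (0 : Euc (n + 1)) ∈ uball (n + 1) := by simp
  have hnull : NullIn {y : p ⁻¹' W | p y ∈ W'} ((restrictOver f p W).comp α) := by
    refine ⟨⟨b 0, hW (hp 0 hb0)⟩, ⟨⟨Hf, hHf⟩, fun s => ?_, fun s => ?_⟩, fun q => hp _ (coneMap n q).2⟩
    · apply Subtype.ext
      simp only [Hf, coneMap]
      change b _ = f (a s)
      rw [← hab s s.2]; simp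
    · apply Subtype.ext
      simp [Hf, coneMap]
  obtain ⟨x, H, -⟩ := h.injective n hn α (fun s => hpa s s.2) hnull
  have hfac : Function.FactorsThrough (fun q => (H q).1) (coneMap n) := by
    rintro ⟨t, s⟩ ⟨t', s'⟩ heq
    have heq' : (1 - (t : ℝ)) • (s : Euc (n + 1)) = (1 - (t' : ℝ)) • (s' : Euc (n + 1)) :=
      congrArg Subtype.val heq
    have hs := norm_of_mem_usphere s.2
    have hs' := norm_of_mem_usphere s'.2
    have ht : (t : ℝ) = t' := by
      have := congrArg norm heq'
      rw [norm_smul, norm_smul, hs, hs', Real.norm_eq_abs, Real.norm_eq_abs,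
        abs_of_nonneg (by linarith [t.2.2]), abs_of_nonneg (by linarith [t'.2.2])] at this
      linarith
    have ht2 : t = t' := Subtype.ext ht
    subst ht2
    by_cases h1 : t = 1
    · subst h1
      simp only [H.apply_one]; rfl
    · have : (1 - (t : ℝ)) ≠ 0 := fun h0 => h1 (Subtype.ext (by change (t : ℝ) = 1; linarith))
      have : s = s' := Subtype.ext (smul_right_injective _ this heq')
      rw [this]
  let Q : C(I × Sph n, uball (n + 1)) := ⟨coneMap n, (isQuotientMap_coneMap n).continuous⟩
  have hQ : IsQuotientMap Q := isQuotientMap_coneMap n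
  let F := hQ.lift ⟨fun q => (H q).1, by fun_prop⟩ hfac
  have hF : ∀ q, F (coneMap n q) = (H q).1 := fun q =>
    congrArg (fun g : C(I × Sph n, X) => g q) (hQ.lift_comp ⟨fun q => (H q).1, by fun_prop⟩ hfac)
  have : Nonempty X := ⟨x.1⟩
  obtain ⟨a', h1, h2⟩ := exists_continuousOn_extension F F.continuous
  refine ⟨a', h1, fun v hv => ?_, fun v hv => ?_⟩
  · have : coneMap n (0, ⟨v, hv⟩) = ⟨v, usphere_subset_uball _ hv⟩ :=
      Subtype.ext (by simp [coneMap])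
    have h3 := h2 ⟨v, usphere_subset_uball _ hv⟩
    rw [← this, hF, H.apply_zero, this] at h3
    exact h3
  · have h3 := h2 ⟨v, hv⟩
    obtain ⟨q, hq⟩ := (isQuotientMap_coneMap n).surjective ⟨v, hv⟩
    rw [← hq, hF, hq] at h3
    simp only at h3
    rw [h3]
    exact (H q).2

/-- A map of the `n`-ball that is constant on the boundary is a based map of `S^n`, the collapsed
boundary being the base point. Based surjectivity then gives `α`, and a homotopy relative to the
base point becomes one relative to the boundary. -/
theorem exists_lift_of_isKEquivStep (hW : W' ⊆ W)
    (h : IsKEquivStep k (restrictOver f p W) {x | p (f x) ∈ W'} {y | p y ∈ W'})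
    (n : ℕ) (hn : n ≤ k) (hn1 : 1 ≤ n) (β : Euc n → Y) (x : X) (hβ : ContinuousOn β (uball n))
    (hx : ∀ v ∈ usphere n, β v = f x) (hp : ∀ v ∈ uball n, p (β v) ∈ W') :
    ∃ (α : Euc n → X) (Γ : Euc n × ℝ → Y), ContinuousOn α (uball n) ∧
      ContinuousOn Γ (uball n ×ˢ Icc 0 1) ∧ (∀ v ∈ usphere n, α v = x) ∧
      (∀ v ∈ uball n, Γ (v, 0) = f (α v)) ∧ (∀ v ∈ uball n, Γ (v, 1) = β v) ∧
      (∀ v ∈ usphere n, ∀ t ∈ Icc (0 : ℝ) 1, Γ (v, t) = f x) ∧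
      (∀ v ∈ uball n, p (f (α v)) ∈ W) ∧
      ∀ v ∈ uball n, ∀ t ∈ Icc (0 : ℝ) 1, p (Γ (v, t)) ∈ W := by
  have hq := isQuotientMap_collapse n hn1
  obtain ⟨v₀, hv₀⟩ : (usphere n).Nonempty := by
    obtain ⟨m, rfl⟩ : ∃ m, n = m + 1 := ⟨n - 1, by omega⟩
    exact ⟨_, (Classical.arbitrary (Sph m)).2⟩
  have hv₀' := usphere_subset_uball _ hv₀
  have hfac : Function.FactorsThrough
      (fun v : uball n => (⟨β v, hW (hp v v.2)⟩ : p ⁻¹' W)) (collapse n) := by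
    intro v v' heq
    rcases eq_of_collapse_eq heq with rfl | ⟨h1, h2⟩
    · rfl
    · exact Subtype.ext ((hx v (by simpa using h1)).trans (hx v' (by simpa using h2)).symm)
  let B₀ : C(uball n, p ⁻¹' W) := ⟨fun v => ⟨β v, hW (hp v v.2)⟩,
    Continuous.subtype_mk (continuousOn_iff_continuous_domRestrict.1 hβ) _⟩
  let Q : C(uball n, Sph n) := ⟨collapse n, hq.continuous⟩
  have hQ : IsQuotientMap Q := hq
  let B := hQ.lift B₀ hfac
  have hB : ∀ v, B (collapse n v) = ⟨β v, hW (hp v v.2)⟩ := fun v =>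
    congrArg (fun g : C(uball n, p ⁻¹' W) => g v) (hQ.lift_comp B₀ hfac)
  have hxW' : p (f x) ∈ W' := by rw [← hx v₀ hv₀]; exact hp v₀ hv₀'
  obtain ⟨α, hα, ⟨H⟩⟩ := h.surjective_based n hn B (fun s => by
      obtain ⟨v, rfl⟩ := hq.surjective s
      rw [mem_ofPred_eq, hB]; exact hp v v.2) (collapse n ⟨v₀, hv₀'⟩) ⟨x, hW hxW'⟩ hxW'
      (by rw [hB]; exact Subtype.ext (hx v₀ hv₀))
  have : Nonempty X := ⟨x⟩
  have : Nonempty Y := ⟨f x⟩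
  obtain ⟨α', h1, h2⟩ := exists_continuousOn_extension (fun v : uball n => (α (collapse n v)).1)
    (by have := hq.continuous; fun_prop)
  classical
  let Γ : Euc n × ℝ → Y := fun q => if hq : q.1 ∈ uball n then
    (H (projIcc 0 1 zero_le_one q.2, collapse n ⟨q.1, hq⟩)).1 else f x
  have hΓ : ∀ v : uball n, ∀ t : ℝ, Γ (v, t) = (H (projIcc 0 1 zero_le_one t, collapse n v)).1 :=
    fun v t => by
      have := v.2
      simp only [Γ, dif_pos this]
  have hcol : ∀ v (hv : v ∈ usphere n),
      collapse n ⟨v, usphere_subset_uball _ hv⟩ = collapse n ⟨v₀, hv₀'⟩ := fun v hv =>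
    collapse_eq_of_norm (by simpa using hv) (by simpa using hv₀)
  refine ⟨α', Γ, h1, ?_, fun v hv => ?_, fun v hv => ?_, fun v hv => ?_, fun v hv t ht => ?_,
    fun v hv => ?_, fun v hv t ht => ?_⟩
  · rw [continuousOn_iff_continuous_domRestrict]
    have : Continuous fun q : (uball n ×ˢ Icc (0 : ℝ) 1 : Set (Euc n × ℝ)) =>
        (H (projIcc 0 1 zero_le_one q.1.2, collapse n ⟨q.1.1, q.2.1⟩)).1 := by
      have h1 := continuous_projIcc (a := (0 : ℝ)) (b := 1) (h := zero_le_one)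
      have h2 := hq.continuous
      have h3 : Continuous fun q : (uball n ×ˢ Icc (0 : ℝ) 1 : Set (Euc n × ℝ)) =>
        (⟨q.1.1, q.2.1⟩ : uball n) := by fun_prop
      have h4 := h2.comp h3
      have h5 := h1.comp (continuous_snd.comp (continuous_subtype_val
        (p := fun q => q ∈ (uball n ×ˢ Icc (0 : ℝ) 1 : Set (Euc n × ℝ)))))
      exact continuous_subtype_val.comp (H.continuous.comp (h5.prodMk h4))
    convert this using 1
    ext q
    exact hΓ ⟨q.1.1, q.2.1⟩ q.1.2
  · have := h2 ⟨v, usphere_subset_uball _ hv⟩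
    rw [hcol v hv, hα] at this
    exact this
  · rw [hΓ ⟨v, hv⟩, h2 ⟨v, hv⟩]
    have : projIcc (0 : ℝ) 1 zero_le_one 0 = 0 := projIcc_left _
    rw [this, H.apply_zero]; rfl
  · rw [hΓ ⟨v, hv⟩]
    have : projIcc (0 : ℝ) 1 zero_le_one 1 = 1 := projIcc_right _
    rw [this, H.apply_one, hB]
  · rw [hΓ ⟨v, usphere_subset_uball _ hv⟩ t, hcol v hv, H.eq_fst _ (mem_singleton _)]
    change f (α _).1 = _
    rw [hα]
  · rw [h2 ⟨v, hv⟩]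
    exact (α _).2
  · rw [hΓ ⟨v, hv⟩ t]
    exact (H _).2

theorem isBallStep_of_isKEquivStep (hW : W' ⊆ W)
    (h : IsKEquivStep k (restrictOver f p W) {x | p (f x) ∈ W'} {y | p y ∈ W'}) :
    IsBallStep k f p W W' :=
  ⟨exists_path_of_isKEquivStep hW h, exists_fill_of_isKEquivStep hW h,
    exists_lift_of_isKEquivStep hW h⟩

end Step

/-- Steps at the scale of gauges. -/
theorem exists_gauge_isBallStep {X : Type u} {Y : Type v} {Z : Type w}
    [TopologicalSpace X] [TopologicalSpace Y] [MetricSpace Z] {k : ℕ} {f : C(X, Y)} {p : C(Y, Z)}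
    (h : IsKShapeEquivNear k f p) {δ : Z → ℝ} (hδ : IsGauge δ) :
    ∃ δ' : Z → ℝ, IsGauge δ' ∧ (∀ z, δ' z ≤ δ z) ∧
      ∀ z, IsBallStep k f p (Metric.ball z (δ z)) (Metric.ball z (δ' z)) := by
  obtain ⟨δ', h1, h2⟩ := exists_gauge
    (fun z r => r ≤ δ z ∧ IsBallStep k f p (Metric.ball z (δ z)) (Metric.ball z r))
    (fun z r s _ hs hr => ⟨hs.trans hr.1, hr.2.mono subset_rfl (Metric.ball_subset_ball hs)⟩)
    (fun z => by
      obtain ⟨W', ho, hz, hW, hst⟩ := h z (Metric.ball z (δ z / 4)) Metric.isOpen_ball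
        (Metric.mem_ball_self (by linarith [hδ.1 z]))
      obtain ⟨r, hr, hrW⟩ := Metric.isOpen_iff.1 ho z hz
      refine ⟨min (r / 2) (δ z / 4), lt_min (half_pos hr) (by linarith [hδ.1 z]), fun w hw => ?_⟩
      have hw1 := hw.trans_le (min_le_left _ _)
      have hw2 := hw.trans_le (min_le_right _ _)
      have hlip := hδ.2 z w
      have hpos := hδ.1 z
      rw [dist_comm] at hlip
      refine ⟨by linarith [min_le_right (r / 2) (δ z / 4)],
        (isBallStep_of_isKEquivStep hW hst).mono ?_ ?_⟩
      · refine Metric.ball_subset_ball' ?_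
        rw [dist_comm]; linarith
      · refine (Metric.ball_subset_ball' ?_).trans hrW
        linarith [min_le_left (r / 2) (δ z / 4)])
  exact ⟨δ', h1, fun z => (h2 z).1, fun z => (h2 z).2⟩

/-! ### Gluing and collars -/

/-- Two functions continuous on closed sets, agreeing on the intersection, can be glued. -/
theorem exists_glue {A T : Type*} [TopologicalSpace A] [TopologicalSpace T] {D s₁ s₂ : Set A}
    (h₁ : IsClosed (D ∩ s₁)) (h₂ : IsClosed (D ∩ s₂)) (hD : D ⊆ s₁ ∪ s₂) {f₁ f₂ : A → T}
    (hf₁ : ContinuousOn f₁ (D ∩ s₁)) (hf₂ : ContinuousOn f₂ (D ∩ s₂))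
    (h : ∀ x ∈ D, x ∈ s₁ → x ∈ s₂ → f₁ x = f₂ x) :
    ∃ F : A → T, ContinuousOn F D ∧ (∀ x ∈ D, x ∈ s₁ → F x = f₁ x) ∧
      ∀ x ∈ D, x ∈ s₂ → F x = f₂ x := by
  classical
  have e₁ : ∀ x ∈ D, x ∈ s₁ → (if x ∈ s₁ then f₁ x else f₂ x) = f₁ x := fun x _ hx => if_pos hx
  have e₂ : ∀ x ∈ D, x ∈ s₂ → (if x ∈ s₁ then f₁ x else f₂ x) = f₂ x := fun x hD hx => by
    split_ifs with h1
    · exact h x hD h1 hx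
    · rfl
  refine ⟨fun x => if x ∈ s₁ then f₁ x else f₂ x, ?_, e₁, e₂⟩
  have : D = (D ∩ s₁) ∪ (D ∩ s₂) := by rw [← inter_union_distrib_left, inter_eq_left.2 hD]
  rw [this]
  exact (hf₁.congr fun x hx => e₁ x hx.1 hx.2).union_of_isClosed
    (hf₂.congr fun x hx => e₂ x hx.1 hx.2) h₁ h₂

theorem continuousOn_normalize {n : ℕ} {s : Set (Euc n)} (h : ∀ v ∈ s, v ≠ 0) :
    ContinuousOn (fun v : Euc n => ‖v‖⁻¹ • v) s :=
  (continuousOn_id.norm.inv₀ fun v hv => norm_ne_zero_iff.2 (h v hv)).smul continuousOn_id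

theorem continuousOn_radial {n : ℕ} {s : Set (Euc n)} (h : ∀ v ∈ s, v ≠ 0) {c : ℝ → ℝ}
    (hc : Continuous c) : ContinuousOn (fun v : Euc n => (c ‖v‖ * ‖v‖⁻¹) • v) s :=
  ((hc.comp continuous_norm).continuousOn.mul
    (continuousOn_id.norm.inv₀ fun v hv => norm_ne_zero_iff.2 (h v hv))).smul continuousOn_id

theorem normalize_mem_usphere {n : ℕ} {v : Euc n} (h : v ≠ 0) : ‖v‖⁻¹ • v ∈ usphere n := by
  simp [norm_smul, h]

/-- A map on the ball together with a homotopy on the boundary gives a map on the ball of twice the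
radius. -/
theorem exists_collar {Y : Type*} [TopologicalSpace Y] {n : ℕ} (h : Euc n × ℝ → Y)
    (ψ : Euc n → Y) (hh : ContinuousOn h (usphere n ×ˢ Icc 0 1)) (hψ : ContinuousOn ψ (uball n))
    (h1 : ∀ v ∈ usphere n, h (v, 1) = ψ v) :
    ∃ b : Euc n → Y, ContinuousOn b (Metric.closedBall 0 2) ∧ (∀ v ∈ uball n, b v = ψ v) ∧
      ∀ v : Euc n, 1 ≤ ‖v‖ → ‖v‖ ≤ 2 → b v = h (‖v‖⁻¹ • v, 2 - ‖v‖) := by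
  have hnz : ∀ v : Euc n, 1 ≤ ‖v‖ → v ≠ 0 := fun v hv h0 => by
    rw [h0, norm_zero] at hv; linarith
  obtain ⟨b, hb, hb1, hb2⟩ := exists_glue (D := Metric.closedBall (0 : Euc n) 2)
    (s₁ := {v | ‖v‖ ≤ 1}) (s₂ := {v | 1 ≤ ‖v‖}) (f₁ := ψ) (f₂ := fun v => h (‖v‖⁻¹ • v, 2 - ‖v‖))
    (Metric.isClosed_closedBall.inter (isClosed_le continuous_norm continuous_const))
    (Metric.isClosed_closedBall.inter (isClosed_le continuous_const continuous_norm))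
    (fun v _ => by simp only [mem_union, mem_ofPred_eq]; exact le_total _ _)
    (hψ.mono fun v hv => by simpa using hv.2)
    (hh.comp ((continuousOn_normalize fun v hv => hnz v hv.2).prodMk (by fun_prop))
      fun v hv => ⟨normalize_mem_usphere (hnz v hv.2), by
        have h2 := hv.1
        have h3 := hv.2
        simp only [mem_ofPred_eq, mem_closedBall_zero_iff] at h2 h3
        exact ⟨by linarith, by linarith⟩⟩)
    (by
      intro v _ hv1 hv2
      have : ‖v‖ = 1 := le_antisymm hv1 hv2
      have h3 : v ∈ usphere n := by simpa using this
      simp only [this, inv_one, one_smul]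
      norm_num
      exact (h1 v h3).symm)
  · refine ⟨b, hb, fun v hv => ?_, fun v hv1 hv2 => ?_⟩
    · have := norm_le_of_mem_uball hv
      exact hb1 v (by rw [mem_closedBall_zero_iff]; linarith) this
    · exact hb2 v (by rwa [mem_closedBall_zero_iff]) hv1

/-! ### The lifting problem over one ball -/

section Cell
variable {X : Type u} {Y : Type v} {Z : Type w}
  [TopologicalSpace X] [TopologicalSpace Y] [TopologicalSpace Z]
  {k : ℕ} {f : C(X, Y)} {p : C(Y, Z)}

/-- On the ball of radius 2, `ψ` inside and `h` in the collar form a map that equals `f ∘ a` on the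
boundary. After rescaling, the strict filling property applies. -/
theorem IsBallStep.exists_fill {A A' : Set Z} (hst : IsBallStep k f p A A') {n : ℕ} (hn1 : 1 ≤ n)
    (hn : n ≤ k + 1) (a : Euc n → X) (h : Euc n × ℝ → Y) (ψ : Euc n → Y)
    (ha : ContinuousOn a (usphere n)) (hh : ContinuousOn h (usphere n ×ˢ Icc 0 1))
    (hψ : ContinuousOn ψ (uball n)) (h0 : ∀ v ∈ usphere n, h (v, 0) = f (a v))
    (h1 : ∀ v ∈ usphere n, h (v, 1) = ψ v)
    (hph : ∀ v ∈ usphere n, ∀ t ∈ Icc (0 : ℝ) 1, p (h (v, t)) ∈ A')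
    (hpψ : ∀ v ∈ uball n, p (ψ v) ∈ A') :
    ∃ g : Euc n → X, ContinuousOn g (uball n) ∧ (∀ v ∈ usphere n, g v = a v) ∧
      ∀ v ∈ uball n, p (f (g v)) ∈ A := by
  obtain ⟨b, hb, hb1, hb2⟩ := exists_collar h ψ hh hψ h1
  obtain ⟨m, rfl⟩ : ∃ m, n = m + 1 := ⟨n - 1, by omega⟩
  have hnorm : ∀ v : Euc (m + 1), ‖(2 : ℝ) • v‖ = 2 * ‖v‖ := fun v => by simp [norm_smul]
  refine hst.fill m (by omega) a (fun v => b ((2 : ℝ) • v)) ha (hb.comp (by fun_prop) ?_) ?_ ?_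
  · intro v hv
    have := norm_le_of_mem_uball hv
    rw [mem_closedBall_zero_iff, hnorm]; linarith
  · intro v hv
    have hv1 := norm_of_mem_usphere hv
    rw [hb2 _ (by rw [hnorm]; linarith) (by rw [hnorm]; linarith), hnorm, hv1, smul_smul]
    norm_num
    exact h0 v hv
  · intro v hv
    have hv1 := norm_le_of_mem_uball hv
    rcases le_total (‖(2 : ℝ) • v‖) 1 with h3 | h3
    · rw [hb1 _ (by simpa using h3)]
      exact hpψ _ (by simpa using h3)
    · rw [hb2 _ h3 (by rw [hnorm]; linarith)]
      refine hph _ (normalize_mem_usphere fun h4 => ?_) _ ?_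
      · rw [h4, norm_zero] at h3; linarith
      · rw [hnorm] at h3 ⊢
        constructor <;> linarith

/-- The radial profile of the homotopy used to extend lifts. -/
theorem profile_bounds {r t : ℝ} (hr : r ≤ 1) (ht : t ∈ Icc (0 : ℝ) 1) :
    0 ≤ (1 - t) * (4 / max r (1 / 2) - 2) + t ∧
      ((1 - t) * (4 / max r (1 / 2) - 2) + t) * r ≤ 3 := by
  have hm : 0 < max r (1 / 2) := lt_max_of_lt_right (by norm_num)
  have h1 : max r (1 / 2) ≤ 1 := max_le hr (by norm_num)
  have h2 : 2 ≤ 4 / max r (1 / 2) - 2 := by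
    rw [le_sub_iff_add_le, le_div_iff₀ hm]; linarith
  have h3 : (4 / max r (1 / 2) - 2) * r ≤ 3 := by
    rcases le_total r (1 / 2) with h | h
    · rw [max_eq_right h]; norm_num; linarith
    · rw [max_eq_left h, sub_mul, div_mul_cancel₀ _ (by linarith)]; linarith
  obtain ⟨ht0, ht1⟩ := ht
  constructor
  · nlinarith
  · nlinarith

/-- Difference-element argument. A filling `g₀` of `a` exists by injectivity, but `f ∘ g₀` and `ψ`
may differ by an element of the `n`-th homotopy group. That element is represented by `B`: `ψ`, then
the collar `h`, then `f ∘ g₀` traversed inwards, ending at the constant `f (g₀ 0)`. Surjectivity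
lifts it to `α`. Inserting `α` at the centre of `g₀` corrects the filling: in the image, `f ∘ g₀`
cancels its reversed copy, leaving `ψ` with its collar. Each half of the argument uses one
shrinking. -/
theorem IsBallStep.exists_lift {A₁ A₂ A₃ : Set Z} (h₁₂ : IsBallStep k f p A₁ A₂)
    (h₂₃ : IsBallStep k f p A₂ A₃) (hA₃ : A₃ ⊆ A₂) (hA₂ : A₂ ⊆ A₁) {n : ℕ} (hn1 : 1 ≤ n)
    (hn : n ≤ k) (a : Euc n → X) (h : Euc n × ℝ → Y) (ψ : Euc n → Y)
    (ha : ContinuousOn a (usphere n)) (hh : ContinuousOn h (usphere n ×ˢ Icc 0 1))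
    (hψ : ContinuousOn ψ (uball n)) (h0 : ∀ v ∈ usphere n, h (v, 0) = f (a v))
    (h1 : ∀ v ∈ usphere n, h (v, 1) = ψ v)
    (hph : ∀ v ∈ usphere n, ∀ t ∈ Icc (0 : ℝ) 1, p (h (v, t)) ∈ A₃)
    (hpψ : ∀ v ∈ uball n, p (ψ v) ∈ A₃) :
    ∃ (g : Euc n → X) (H : Euc n × ℝ → Y), ContinuousOn g (uball n) ∧
      ContinuousOn H (uball n ×ˢ Icc 0 1) ∧ (∀ v ∈ usphere n, g v = a v) ∧
      (∀ v ∈ uball n, H (v, 0) = f (g v)) ∧ (∀ v ∈ uball n, H (v, 1) = ψ v) ∧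
      (∀ v ∈ usphere n, ∀ t ∈ Icc (0 : ℝ) 1, H (v, t) = h (v, t)) ∧
      (∀ v ∈ uball n, p (f (g v)) ∈ A₁) ∧
      ∀ v ∈ uball n, ∀ t ∈ Icc (0 : ℝ) 1, p (H (v, t)) ∈ A₁ := by
  obtain ⟨g₀, hg₀, hg₀a, hg₀p⟩ :=
    h₂₃.exists_fill hn1 (by omega) a h ψ ha hh hψ h0 h1 hph hpψ
  obtain ⟨b, hb, hb1, hb2⟩ := exists_collar h ψ hh hψ h1
  have hnz : ∀ v : Euc n, 1 / 2 ≤ ‖v‖ → v ≠ 0 := fun v hv h0 => by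
    rw [h0, norm_zero] at hv; linarith
  have hscale : ∀ (c : ℝ) (v : Euc n), v ≠ 0 → 0 ≤ c → ‖(c * ‖v‖⁻¹) • v‖ = c := fun c v hv hc => by
    have : ‖v‖ ≠ 0 := norm_ne_zero_iff.2 hv
    rw [norm_smul, Real.norm_eq_abs, abs_of_nonneg (by positivity)]; field_simp
  -- extension by the image of the filling to the ball of radius three
  obtain ⟨B, hB, hB1, hB2⟩ := exists_glue (D := Metric.closedBall (0 : Euc n) 3)
    (s₁ := {v | ‖v‖ ≤ 2}) (s₂ := {v | 2 ≤ ‖v‖}) (f₁ := b)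
    (f₂ := fun v => f (g₀ (((3 - ‖v‖) * ‖v‖⁻¹) • v)))
    (Metric.isClosed_closedBall.inter (isClosed_le continuous_norm continuous_const))
    (Metric.isClosed_closedBall.inter (isClosed_le continuous_const continuous_norm))
    (fun v _ => by simp only [mem_union, mem_ofPred_eq]; exact le_total _ _) (hb.mono fun v hv => by simpa using hv.2)
    (by
      refine f.continuous.comp_continuousOn (hg₀.comp ?_ ?_)
      · exact continuousOn_radial (fun v hv => hnz v (by linarith [hv.2.out]))
          (c := fun r => 3 - r) (by fun_prop)
      · intro v hv
        have h3 := hv.1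
        have h4 := hv.2.out
        rw [mem_closedBall_zero_iff] at h3
        rw [mem_closedBall_zero_iff, hscale _ _ (hnz v (by linarith)) (by linarith)]
        linarith)
    (by
      intro v _ h3 h4
      have h5 : ‖v‖ = 2 := le_antisymm h3 h4
      have h6 := normalize_mem_usphere (hnz v (by linarith))
      rw [hb2 v (by linarith) h3, h5]
      norm_num
      rw [h5] at h6
      norm_num at h6
      rw [h0 _ (by simpa using h6), hg₀a _ (by simpa using h6)])
  have hBp : ∀ v : Euc n, ‖v‖ ≤ 3 → p (B v) ∈ A₂ := by
    intro v hv
    rcases le_total ‖v‖ 2 with h2 | h2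
    · rw [hB1 v (by simpa using hv) h2]
      rcases le_total ‖v‖ 1 with h3 | h3
      · rw [hb1 v (by simpa using h3)]; exact hA₃ (hpψ v (by simpa using h3))
      · rw [hb2 v h3 h2]
        exact hA₃ (hph _ (normalize_mem_usphere (hnz v (by linarith))) _
          ⟨by linarith, by linarith⟩)
    · rw [hB2 v (by simpa using hv) h2]
      apply hg₀p
      rw [mem_closedBall_zero_iff, hscale _ _ (hnz v (by linarith)) (by linarith)]
      linarith
  have hB3 : ∀ v : Euc n, ‖v‖ = 3 → B v = f (g₀ 0) := fun v hv => by
    rw [hB2 v (by simp [hv]) (by simp only [mem_ofPred_eq, hv]; norm_num), hv]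
    simp
  have hn3 : ∀ (c : ℝ) (v : Euc n), 0 ≤ c → ‖c • v‖ = c * ‖v‖ := fun c v hc => by
    rw [norm_smul, Real.norm_eq_abs, abs_of_nonneg hc]
  -- The factor 3 rescales the domain of `B`, on whose boundary sphere `B` is constant.
  obtain ⟨α, Γ, hα, hΓ, hα1, hΓ0, hΓ1, hΓs, hαp, hΓp⟩ := h₁₂.lift n hn hn1
    (fun v => B ((3 : ℝ) • v)) (g₀ 0)
    (hB.comp (by fun_prop) fun v hv => by
      have := norm_le_of_mem_uball hv
      rw [mem_closedBall_zero_iff, hn3 3 v (by norm_num)]; linarith)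
    (fun v hv => hB3 _ (by rw [hn3 3 v (by norm_num), norm_of_mem_usphere hv, mul_one]))
    (fun v hv => hBp _ (by
      have := norm_le_of_mem_uball hv
      rw [hn3 3 v (by norm_num)]; linarith))
  have h2b : ∀ v : Euc n, ‖v‖ ≤ 1 / 2 → (2 : ℝ) • v ∈ uball n := fun v hv => by
    rw [mem_closedBall_zero_iff, hn3 2 v (by norm_num)]; linarith
  have h2s : ∀ v : Euc n, ‖v‖ = 1 / 2 → (2 : ℝ) • v ∈ usphere n := fun v hv => by
    rw [mem_sphere_zero_iff_norm, hn3 2 v (by norm_num), hv]; norm_num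
  have hclosed₁ : IsClosed {v : Euc n | ‖v‖ ≤ 1 / 2} := isClosed_le continuous_norm continuous_const
  have hclosed₂ : IsClosed {v : Euc n | 1 / 2 ≤ ‖v‖} := isClosed_le continuous_const continuous_norm
  -- The corrected filling: `α` on the half-size ball, then all of `g₀` stretched over the outer
  -- shell.
  obtain ⟨g, hg, hg1, hg2⟩ := exists_glue (D := uball n) (s₁ := {v | ‖v‖ ≤ 1 / 2})
    (s₂ := {v | 1 / 2 ≤ ‖v‖}) (f₁ := fun v => α ((2 : ℝ) • v))
    (f₂ := fun v => g₀ (((2 * ‖v‖ - 1) * ‖v‖⁻¹) • v))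
    (Metric.isClosed_closedBall.inter hclosed₁) (Metric.isClosed_closedBall.inter hclosed₂)
    (fun v _ => by simp only [mem_union, mem_ofPred_eq]; exact le_total _ _) (hα.comp (by fun_prop) fun v hv => h2b v hv.2)
    (by
      refine hg₀.comp ?_ ?_
      · exact continuousOn_radial (fun v hv => hnz v hv.2.out)
          (c := fun r => 2 * r - 1) (by fun_prop)
      · intro v hv
        have h3 := norm_le_of_mem_uball hv.1
        have h4 := hv.2.out
        rw [mem_closedBall_zero_iff, hscale _ _ (hnz v h4) (by linarith)]
        linarith)
    (by
      intro v _ h3 h4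
      have h5 : ‖v‖ = 1 / 2 := le_antisymm h3 h4
      rw [hα1 _ (h2s v h5), h5]
      norm_num)
  -- Radial factor of the cancelling homotopy. At time 0, radius `r` goes to `6 r` for `r ≤ 1/2` and
  -- to `4 - 2 r` beyond, so the shell runs over the copy of `f ∘ g₀` in `B`. At time 1 the factor
  -- is 1, leaving `ψ`. On the unit sphere it is `2 - t`, which sweeps the collar and so reproduces
  -- `h`.
  let κ : Euc n × ℝ → ℝ := fun q => (1 - q.2) * (4 / max ‖q.1‖ (1 / 2) - 2) + q.2
  have hκ : Continuous κ := by
    have : ∀ q : Euc n × ℝ, max ‖q.1‖ (1 / 2) ≠ 0 := fun q =>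
      (lt_max_of_lt_right (by norm_num : (0 : ℝ) < 1 / 2)).ne'
    unfold κ
    fun_prop (disch := exact this _)
  -- Delayed time: it waits until `t = 1/2` on the inner ball, leaving room for `Γ`, but is
  -- undelayed on the unit sphere, where `h` must be reproduced exactly.
  let τ : Euc n × ℝ → ℝ := fun q =>
    max 0 ((q.2 - min (1 / 2) (1 - ‖q.1‖)) / (1 - min (1 / 2) (1 - ‖q.1‖)))
  have hτd : ∀ q : Euc n × ℝ, 0 < 1 - min (1 / 2) (1 - ‖q.1‖) := fun q => by
    have := min_le_left (1 / 2) (1 - ‖q.1‖)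
    linarith
  have hτ : Continuous τ := by
    exact continuous_const.max
      (Continuous.div₀ (by fun_prop) (by fun_prop) fun q => (hτd q).ne')
  have hτI : ∀ q : Euc n × ℝ, q.2 ∈ Icc (0 : ℝ) 1 → τ q ∈ Icc (0 : ℝ) 1 := fun q hq => by
    refine ⟨le_max_left _ _, max_le zero_le_one ?_⟩
    rw [div_le_one (hτd q)]; linarith [hq.2]
  have hτ0 : ∀ v ∈ uball n, τ (v, 0) = 0 := fun v hv => by
    have := norm_le_of_mem_uball hv
    refine max_eq_left (div_nonpos_of_nonpos_of_nonneg ?_ (hτd _).le)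
    have : 0 ≤ min (1 / 2) (1 - ‖v‖) := le_min (by norm_num) (by linarith)
    simpa using this
  have hτ1 : ∀ v : Euc n, τ (v, 1) = 1 := fun v => by
    simp only [τ]
    rw [div_self (hτd (v, 1)).ne']; simp
  have hτs : ∀ v ∈ usphere n, ∀ t ∈ Icc (0 : ℝ) 1, τ (v, t) = t := fun v hv t ht => by
    simp only [τ, norm_of_mem_usphere hv]
    norm_num; exact ht.1
  have hτh : ∀ (v : Euc n) (t : ℝ), ‖v‖ ≤ 1 / 2 → t ≤ 1 / 2 → τ (v, t) = 0 := fun v t hv ht => by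
    refine max_eq_left (div_nonpos_of_nonpos_of_nonneg ?_ (hτd _).le)
    have : min (1 / 2) (1 - ‖v‖) = 1 / 2 := min_eq_left (by linarith)
    simp only [this]; linarith
  let H₂ : Euc n × ℝ → Y := fun q => B (κ (q.1, τ q) • q.1)
  have hκn : ∀ q : Euc n × ℝ, q.1 ∈ uball n → q.2 ∈ Icc (0 : ℝ) 1 → ‖κ (q.1, τ q) • q.1‖ ≤ 3 :=
    fun q hq hq' => by
      obtain ⟨h3, h4⟩ := profile_bounds (norm_le_of_mem_uball hq) (hτI q hq')
      rw [hn3 _ _ h3]; exact h4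
  have hκ0 : ∀ v : Euc n, ‖v‖ ≤ 1 / 2 → κ (v, 0) = 6 := fun v hv => by
    simp only [κ, max_eq_right hv]; norm_num
  have hH₂ : ContinuousOn H₂ (uball n ×ˢ Icc 0 1) :=
    hB.comp (by fun_prop) fun q hq => by rw [mem_closedBall_zero_iff]; exact hκn q hq.1 hq.2
  have hD : IsClosed (uball n ×ˢ Icc (0 : ℝ) 1) := Metric.isClosed_closedBall.prod isClosed_Icc
  obtain ⟨H, hH, hHa, hHb⟩ := exists_glue (D := uball n ×ˢ Icc (0 : ℝ) 1)
    (s₁ := {q | ‖q.1‖ ≤ 1 / 2} ∩ {q | q.2 ≤ 1 / 2}) (s₂ := {q | 1 / 2 ≤ ‖q.1‖} ∪ {q | 1 / 2 ≤ q.2})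
    (f₁ := fun q => Γ ((2 : ℝ) • q.1, 2 * q.2)) (f₂ := H₂)
    (hD.inter ((isClosed_le (by fun_prop) (by fun_prop)).inter
      (isClosed_le (by fun_prop) (by fun_prop))))
    (hD.inter ((isClosed_le (by fun_prop) (by fun_prop)).union
      (isClosed_le (by fun_prop) (by fun_prop))))
    (by
      intro q _
      rcases le_total ‖q.1‖ (1 / 2) with h3 | h3
      · rcases le_total q.2 (1 / 2) with h4 | h4
        · exact Or.inl ⟨h3, h4⟩
        · exact Or.inr (Or.inr h4)
      · exact Or.inr (Or.inl h3))
    (hΓ.comp (by fun_prop) fun q hq => ⟨h2b _ hq.2.1, by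
      have h3 := hq.1.2.1
      have h4 := hq.2.2.out
      constructor <;> dsimp only <;> linarith⟩)
    (hH₂.mono inter_subset_left)
    (by
      rintro ⟨v, t⟩ ⟨hv, ht⟩ ⟨h3, h4⟩ h5
      simp only [mem_ofPred_eq] at h3 h4 h5 ht hv
      simp only [H₂, hτh v t h3 h4, hκ0 v h3]
      rcases h5 with h5 | h5
      · have h6 : ‖v‖ = 1 / 2 := le_antisymm h3 h5
        rw [hΓs _ (h2s v h6) _ ⟨by linarith [ht.1], by linarith⟩, hB3]
        rw [hn3 _ _ (by norm_num), h6]; norm_num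
      · have h6 : t = 1 / 2 := le_antisymm h4 h5
        have := hΓ1 _ (h2b v h3)
        rw [h6]
        norm_num
        rw [this, smul_smul]; norm_num)
  refine ⟨g, H, hg, hH, fun v hv => ?_, fun v hv => ?_, fun v hv => ?_, fun v hv t ht => ?_,
    fun v hv => ?_, fun v hv t ht => ?_⟩
  · have h3 := norm_of_mem_usphere hv
    rw [hg2 v (usphere_subset_uball _ hv) (by simp only [mem_ofPred_eq, h3]; norm_num), h3]
    norm_num
    exact hg₀a v hv
  · rcases le_total ‖v‖ (1 / 2) with h3 | h3
    · rw [hHa (v, 0) ⟨hv, by simp⟩ ⟨h3, by simp⟩, hg1 v hv h3]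
      simpa using hΓ0 _ (h2b v h3)
    · have hv1 := norm_le_of_mem_uball hv
      have hk : κ (v, 0) = 4 / ‖v‖ - 2 := by simp only [κ, max_eq_left h3]; ring
      have hv0 : ‖v‖ ≠ 0 := by linarith
      have hkn : ‖κ (v, 0) • v‖ = 4 - 2 * ‖v‖ := by
        rw [hk, hn3 _ _ (by rw [le_sub_iff_add_le, le_div_iff₀ (by linarith)]; linarith)]
        field_simp
      rw [hHb (v, 0) ⟨hv, by simp⟩ (Or.inl h3), hg2 v hv h3]
      simp only [H₂, hτ0 v hv]
      rw [hB2 _ (by rw [mem_closedBall_zero_iff, hkn]; linarith)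
        (by rw [mem_ofPred_eq, hkn]; linarith), hkn, hk, smul_smul]
      congr 3
      have : 4 - 2 * ‖v‖ ≠ 0 := by linarith
      field_simp
      ring
  · rw [hHb (v, 1) ⟨hv, by simp⟩ (Or.inr (by simp only [mem_ofPred_eq]; norm_num))]
    have : κ (v, 1) = 1 := by simp [κ]
    have hv1 := norm_le_of_mem_uball hv
    simp only [H₂, hτ1 v, this, one_smul]
    rw [hB1 v (by rw [mem_closedBall_zero_iff]; linarith) (by rw [mem_ofPred_eq]; linarith),
      hb1 v hv]
  · have h3 := norm_of_mem_usphere hv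
    have hk : κ (v, t) = 2 - t := by
      simp only [κ, h3]; norm_num; ring
    have hkn : ‖(2 - t) • v‖ = 2 - t := by rw [hn3 _ _ (by linarith [ht.2]), h3, mul_one]
    rw [hHb (v, t) ⟨usphere_subset_uball _ hv, ht⟩
      (Or.inl (by simp only [mem_ofPred_eq, h3]; norm_num))]
    simp only [H₂, hτs v hv t ht, hk]
    rw [hB1 _ (by rw [mem_closedBall_zero_iff, hkn]; linarith [ht.1])
      (by rw [mem_ofPred_eq, hkn]; linarith [ht.1]), hb2 _ (by rw [hkn]; linarith [ht.2])
      (by rw [hkn]; linarith [ht.1]), hkn, smul_smul, inv_mul_cancel₀ (by linarith [ht.2]), one_smul]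
    congr 2
    ring
  · rcases le_total ‖v‖ (1 / 2) with h3 | h3
    · rw [hg1 v hv h3]; exact hαp _ (h2b v h3)
    · have hv1 := norm_le_of_mem_uball hv
      rw [hg2 v hv h3]
      refine hA₂ (hg₀p _ ?_)
      rw [mem_closedBall_zero_iff, hscale _ _ (hnz v h3) (by linarith)]
      linarith
  · by_cases h3 : ‖v‖ ≤ 1 / 2 ∧ t ≤ 1 / 2
    · rw [hHa (v, t) ⟨hv, ht⟩ h3]
      exact hΓp _ (h2b v h3.1) _ ⟨by linarith [ht.1], by linarith [h3.2]⟩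
    · rw [hHb (v, t) ⟨hv, ht⟩ (by
        rcases not_and_or.1 h3 with h | h
        · exact Or.inl (not_le.1 h).le
        · exact Or.inr (not_le.1 h).le)]
      exact hA₂ (hBp _ (hκn (v, t) hv ht))

end Cell

/-! ### Cells -/

/-- `S` is homeomorphic to the closed ball of dimension `n`, with boundary sphere `B`. -/
def IsCell {A : Type*} [TopologicalSpace A] (n : ℕ) (S B : Set A) : Prop :=
  ∃ (P : Euc n → A) (Q : A → Euc n), ContinuousOn P (uball n) ∧ ContinuousOn Q S ∧
    MapsTo P (uball n) S ∧ MapsTo Q S (uball n) ∧ MapsTo P (usphere n) B ∧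
    MapsTo Q B (usphere n) ∧ (∀ x ∈ S, P (Q x) = x) ∧ B ⊆ S

theorem IsCell.of_chart {A V : Type*} [TopologicalSpace A] [TopologicalSpace V] {n : ℕ}
    {C D : Set V} {S B : Set A} (h : IsCell n C D) (P : V → A) (Q : A → V)
    (hP : ContinuousOn P C) (hQ : ContinuousOn Q S) (hPS : MapsTo P C S) (hQC : MapsTo Q S C)
    (hPB : MapsTo P D B) (hQD : MapsTo Q B D) (hPQ : ∀ x ∈ S, P (Q x) = x) (hBS : B ⊆ S) :
    IsCell n S B := by
  obtain ⟨P', Q', h1, h2, h3, h4, h5, h6, h7, -⟩ := h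
  exact ⟨P ∘ P', Q' ∘ Q, hP.comp h1 h3, h2.comp hQ hQC, hPS.comp h3, h4.comp hQC, hPB.comp h5,
    h6.comp hQD, fun x hx => by simp [h7 _ (hQC hx), hPQ x hx], hBS⟩

/-- After a linear identification with Euclidean space, a homeomorphism of the whole space carries
the convex body to the unit ball and its frontier to the sphere. -/
theorem isCell_of_convex {V : Type*} [NormedAddCommGroup V] [NormedSpace ℝ V]
    [FiniteDimensional ℝ V] {C : Set V} (hC : Convex ℝ C) (hcomp : IsCompact C)
    (hne : (interior C).Nonempty) {n : ℕ} (hn : Module.finrank ℝ V = n) :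
    IsCell n C (frontier C) := by
  let L : V ≃L[ℝ] Euc n := ContinuousLinearEquiv.ofFinrankEq (by rw [hn]; simp)
  have hint : interior (L '' C) = L '' interior C := (L.toHomeomorph.image_interior C).symm
  have hfr : frontier (L '' C) = L '' frontier C := (L.toHomeomorph.image_frontier C).symm
  obtain ⟨Φ, -, h2, h3⟩ := exists_homeomorph_image_interior_closure_frontier_eq_unitBall
    (s := L '' C) (hC.linear_image L.toLinearEquiv.toLinearMap) (by rw [hint]; exact hne.image _)
    (hcomp.image L.continuous).isBounded
  rw [(hcomp.image L.continuous).isClosed.closure_eq] at h2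
  rw [hfr] at h3
  have hΦ : ∀ v, v ∈ C ↔ Φ (L v) ∈ uball n := fun v => by
    rw [uball, ← h2, Φ.injective.mem_set_image, L.injective.mem_set_image]
  have hΦ' : ∀ v, v ∈ frontier C ↔ Φ (L v) ∈ usphere n := fun v => by
    rw [usphere, ← h3, Φ.injective.mem_set_image, L.injective.mem_set_image]
  refine ⟨fun v => L.symm (Φ.symm v), fun v => Φ (L v), by fun_prop, by fun_prop,
    fun v hv => ?_, fun v hv => (hΦ v).1 hv, fun v hv => ?_, fun v hv => (hΦ' v).1 hv,
    fun x _ => by simp, hcomp.isClosed.frontier_subset⟩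
  · rw [hΦ]; simpa using hv
  · rw [hΦ']; simpa using hv

section Cell
variable {X : Type u} {Y : Type v} {Z : Type w}
  [TopologicalSpace X] [TopologicalSpace Y] [TopologicalSpace Z]
  {k : ℕ} {f : C(X, Y)} {p : C(Y, Z)}

/-- The uniform statement used in the induction: a path to a lifted point for `n = 0`, lift with
homotopy for `1 ≤ n ≤ k`, filling alone for `n = k + 1`. In the last case `H` is a placeholder, so
its properties are conditional on `n ≤ k`. -/
theorem IsBallStep.exists_ball_lift {A₁ A₂ A₃ : Set Z} (h₁₂ : IsBallStep k f p A₁ A₂)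
    (h₂₃ : IsBallStep k f p A₂ A₃) (hA₃ : A₃ ⊆ A₂) (hA₂ : A₂ ⊆ A₁) {n : ℕ}
    (hn : n ≤ k + 1) (a : Euc n → X) (h : Euc n × ℝ → Y) (ψ : Euc n → Y)
    (ha : ContinuousOn a (usphere n)) (hh : ContinuousOn h (usphere n ×ˢ Icc 0 1))
    (hψ : ContinuousOn ψ (uball n)) (h0 : ∀ v ∈ usphere n, h (v, 0) = f (a v))
    (h1 : ∀ v ∈ usphere n, h (v, 1) = ψ v)
    (hph : ∀ v ∈ usphere n, ∀ t ∈ Icc (0 : ℝ) 1, p (h (v, t)) ∈ A₃)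
    (hpψ : ∀ v ∈ uball n, p (ψ v) ∈ A₃) :
    ∃ (g : Euc n → X) (H : Euc n × ℝ → Y), ContinuousOn g (uball n) ∧
      (∀ v ∈ usphere n, g v = a v) ∧ (∀ v ∈ uball n, p (f (g v)) ∈ A₁) ∧
      (n ≤ k → ContinuousOn H (uball n ×ˢ Icc 0 1) ∧
        (∀ v ∈ uball n, H (v, 0) = f (g v)) ∧ (∀ v ∈ uball n, H (v, 1) = ψ v) ∧
        (∀ v ∈ usphere n, ∀ t ∈ Icc (0 : ℝ) 1, H (v, t) = h (v, t)) ∧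
        ∀ v ∈ uball n, ∀ t ∈ Icc (0 : ℝ) 1, p (H (v, t)) ∈ A₁) := by
  rcases Nat.eq_zero_or_pos n with rfl | hn1
  · have hz : (0 : Euc 0) ∈ uball 0 := by simp
    have hs : ∀ v : Euc 0, v ∉ usphere 0 := fun v hv => by
      have := norm_of_mem_usphere hv
      rw [Subsingleton.elim v 0, norm_zero] at this
      exact zero_ne_one this
    obtain ⟨x, γ, hγ, hγ0, hγ1, hx, hγp⟩ := h₁₂.vertex (ψ 0) (hA₃ (hpψ 0 hz))
    exact ⟨fun _ => x, fun q => γ q.2, continuousOn_const, fun v hv => (hs v hv).elim,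
      fun _ _ => hx, fun _ => ⟨hγ.comp continuousOn_snd fun q hq => hq.2, fun _ _ => hγ0,
        fun v _ => by rw [Subsingleton.elim v 0]; exact hγ1, fun v hv => (hs v hv).elim,
        fun _ _ t ht => hγp t ht⟩⟩
  · rcases Nat.lt_or_ge k n with hk | hk
    · obtain ⟨g, h1, h2, h3⟩ := h₂₃.exists_fill hn1 hn a h ψ ha hh hψ h0 h1 hph hpψ
      exact ⟨g, h, h1, h2, fun v hv => hA₂ (h3 v hv), fun h => by omega⟩
    · obtain ⟨g, H, h1, h2, h3, h4, h5, h6, h7, h8⟩ :=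
        h₁₂.exists_lift h₂₃ hA₃ hA₂ hn1 hk a h ψ ha hh hψ h0 h1 hph hpψ
      exact ⟨g, H, h1, h3, h7, fun _ => ⟨h2, h4, h5, h6, h8⟩⟩

theorem IsBallStep.exists_cell_lift {A₁ A₂ A₃ : Set Z} (h₁₂ : IsBallStep k f p A₁ A₂)
    (h₂₃ : IsBallStep k f p A₂ A₃) (hA₃ : A₃ ⊆ A₂) (hA₂ : A₂ ⊆ A₁) {n : ℕ}
    (hn : n ≤ k + 1) {A : Type*} [TopologicalSpace A] {S B : Set A} (hS : IsCell n S B)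
    (a : A → X) (h : A × ℝ → Y) (ψ : A → Y)
    (ha : ContinuousOn a B) (hh : ContinuousOn h (B ×ˢ Icc 0 1))
    (hψ : ContinuousOn ψ S) (h0 : ∀ v ∈ B, h (v, 0) = f (a v))
    (h1 : ∀ v ∈ B, h (v, 1) = ψ v)
    (hph : ∀ v ∈ B, ∀ t ∈ Icc (0 : ℝ) 1, p (h (v, t)) ∈ A₃)
    (hpψ : ∀ v ∈ S, p (ψ v) ∈ A₃) :
    ∃ (g : A → X) (H : A × ℝ → Y), ContinuousOn g S ∧
      (∀ v ∈ B, g v = a v) ∧ (∀ v ∈ S, p (f (g v)) ∈ A₁) ∧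
      (n ≤ k → ContinuousOn H (S ×ˢ Icc 0 1) ∧
        (∀ v ∈ S, H (v, 0) = f (g v)) ∧ (∀ v ∈ S, H (v, 1) = ψ v) ∧
        (∀ v ∈ B, ∀ t ∈ Icc (0 : ℝ) 1, H (v, t) = h (v, t)) ∧
        ∀ v ∈ S, ∀ t ∈ Icc (0 : ℝ) 1, p (H (v, t)) ∈ A₁) := by
  obtain ⟨P, Q, hP, hQ, hPS, hQS, hPB, hQB, hPQ, hBS⟩ := hS
  obtain ⟨g, H, hg, hga, hgp, hH⟩ := h₁₂.exists_ball_lift h₂₃ hA₃ hA₂ hn (fun v => a (P v))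
    (fun q => h (P q.1, q.2)) (fun v => ψ (P v))
    (ha.comp (hP.mono (usphere_subset_uball n)) hPB)
    (hh.comp (((hP.mono (usphere_subset_uball n)).comp continuousOn_fst fun q hq => hq.1).prodMk
      continuousOn_snd) fun q hq => ⟨hPB hq.1, hq.2⟩)
    (hψ.comp hP hPS) (fun v hv => h0 _ (hPB hv)) (fun v hv => h1 _ (hPB hv))
    (fun v hv t ht => hph _ (hPB hv) t ht) (fun v hv => hpψ _ (hPS hv))
  refine ⟨fun x => g (Q x), fun q => H (Q q.1, q.2), hg.comp hQ hQS, fun x hx => ?_,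
    fun x hx => hgp _ (hQS hx), fun hk => ?_⟩
  · exact (hga _ (hQB hx)).trans (by rw [hPQ x (hBS hx)])
  · obtain ⟨h2, h3, h4, h5, h6⟩ := hH hk
    refine ⟨h2.comp ((hQ.comp continuousOn_fst fun q hq => hq.1).prodMk continuousOn_snd)
      fun q hq => ⟨hQS hq.1, hq.2⟩, fun x hx => h3 _ (hQS hx), fun x hx => ?_, fun x hx t ht => ?_,
      fun x hx => h6 _ (hQS hx)⟩
    · simp only
      rw [h4 _ (hQS hx), hPQ x hx]
    · simp only
      rw [h5 _ (hQB hx) t ht, hPQ x (hBS hx)]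

end Cell

/-! ### Coordinate simplices and prisms -/

/-- The simplex spanned by the coordinate vectors of a finite set. -/
def coordSimplex {ι : Type*} (s : Finset ι) : Set (ι → ℝ) :=
  {x | (∀ a, 0 ≤ x a) ∧ (∀ a ∉ s, x a = 0) ∧ ∑ a ∈ s, x a = 1}

/-- The boundary of a coordinate simplex. -/
def coordBoundary {ι : Type*} (s : Finset ι) : Set (ι → ℝ) :=
  {x | x ∈ coordSimplex s ∧ ∃ a ∈ s, x a = 0}

theorem isClosed_coordSimplex {ι : Type*} (s : Finset ι) : IsClosed (coordSimplex s) := by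
  have : coordSimplex s = (⋂ a, {x : ι → ℝ | 0 ≤ x a}) ∩ (⋂ a, ⋂ (_ : a ∉ s), {x | x a = 0}) ∩
      {x | ∑ a ∈ s, x a = 1} := by
    ext x; simp [coordSimplex, and_assoc]
  rw [this]
  refine ((isClosed_iInter fun a => isClosed_le (by fun_prop) (by fun_prop)).inter
    (isClosed_iInter fun a => isClosed_iInter fun _ => isClosed_eq (by fun_prop)
      (by fun_prop))).inter (isClosed_eq (by fun_prop) (by fun_prop))

theorem coordSimplex_mono {ι : Type*} {s τ : Finset ι} (h : s ⊆ τ) :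
    coordSimplex s ⊆ coordSimplex τ := by
  rintro x ⟨h1, h2, h3⟩
  refine ⟨h1, fun a ha => h2 a fun h' => ha (h h'), ?_⟩
  rw [← h3]
  exact (Finset.sum_subset h fun a _ ha => h2 a ha).symm

theorem mem_coordSimplex_of_zero {ι : Type*} [DecidableEq ι] {s : Finset ι} {x : ι → ℝ}
    (hx : x ∈ coordSimplex s) {a : ι} (ha : x a = 0) : x ∈ coordSimplex (s.erase a) := by
  refine ⟨hx.1, fun b hb => ?_, ?_⟩
  · by_cases h : b = a
    · rw [h, ha]
    · exact hx.2.1 b fun h' => hb (Finset.mem_erase.2 ⟨h, h'⟩)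
  · rw [Finset.sum_erase _ ha]; exact hx.2.2

theorem nonempty_of_mem_coordSimplex {ι : Type*} {s : Finset ι} {x : ι → ℝ}
    (hx : x ∈ coordSimplex s) : s.Nonempty := by
  rw [Finset.nonempty_iff_ne_empty]
  rintro rfl
  simpa using hx.2.2

theorem coordBoundary_eq_biUnion {ι : Type*} [DecidableEq ι] (s : Finset ι) :
    coordBoundary s = ⋃ a ∈ s, coordSimplex (s.erase a) := by
  ext x
  simp only [mem_iUnion, exists_prop]
  constructor
  · rintro ⟨hx, a, ha, h0⟩
    exact ⟨a, ha, mem_coordSimplex_of_zero hx h0⟩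
  · rintro ⟨a, ha, hx⟩
    exact ⟨coordSimplex_mono (Finset.erase_subset _ _) hx, a, ha, hx.2.1 a (by simp)⟩

/-- The solid coordinate corner `{y ≥ 0, ∑ y ≤ 1}`. -/
def corner (κ : Type*) [Fintype κ] : Set (κ → ℝ) := {y | (∀ a, 0 ≤ y a) ∧ ∑ a, y a ≤ 1}

section Corner
variable {κ : Type*} [Fintype κ]

theorem isClosed_corner : IsClosed (corner κ) := by
  have : corner κ = (⋂ a, {x : κ → ℝ | 0 ≤ x a}) ∩ {x | ∑ a, x a ≤ 1} := by
    ext x; simp [corner]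
  rw [this]
  exact (isClosed_iInter fun a => isClosed_le (by fun_prop) (by fun_prop)).inter
    (isClosed_le (by fun_prop) (by fun_prop))

theorem isCompact_corner : IsCompact (corner κ) := by
  refine Metric.isCompact_of_isClosed_isBounded isClosed_corner
    ((Metric.isBounded_closedBall (x := (0 : κ → ℝ)) (r := 1)).subset fun y hy => ?_)
  rw [mem_closedBall_zero_iff, pi_norm_le_iff_of_nonneg zero_le_one]
  intro a
  rw [Real.norm_eq_abs, abs_of_nonneg (hy.1 a)]
  exact (Finset.single_le_sum (fun b _ => hy.1 b) (Finset.mem_univ a)).trans hy.2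

theorem convex_corner : Convex ℝ (corner κ) := by
  intro x hx y hy s t hs ht hst
  refine ⟨fun a => ?_, ?_⟩
  · have := hx.1 a
    have := hy.1 a
    simp only [Pi.add_apply, Pi.smul_apply, smul_eq_mul]
    positivity
  · simp only [Pi.add_apply, Pi.smul_apply, smul_eq_mul, Finset.sum_add_distrib, ← Finset.mul_sum]
    nlinarith [hx.2, hy.2]

theorem interior_corner : interior (corner κ) = {y | (∀ a, 0 < y a) ∧ ∑ a, y a < 1} := by
  classical
  apply subset_antisymm
  · intro y hy
    have hyC := interior_subset hy
    rw [mem_interior_iff_mem_nhds] at hy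
    -- An interior point can be moved slightly in every direction. The direction with all
    -- coordinates `-1` forces positive coordinates, and a basis vector forces sum below 1.
    have key : ∀ v : κ → ℝ, ∃ ε > (0 : ℝ), y + ε • v ∈ corner κ := by
      intro v
      have : Filter.Tendsto (fun ε : ℝ => y + ε • v) (𝓝[>] 0) (𝓝 y) := by
        have : Continuous fun ε : ℝ => y + ε • v := by fun_prop
        simpa using (this.tendsto 0).mono_left nhdsWithin_le_nhds
      obtain ⟨ε, h1, h2⟩ := ((this.eventually hy).and self_mem_nhdsWithin).exists
      exact ⟨ε, h2, h1⟩
    refine ⟨fun a => ?_, ?_⟩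
    · obtain ⟨ε, hε, h⟩ := key (fun _ => -1)
      have := h.1 a
      simp only [Pi.add_apply, Pi.smul_apply, smul_eq_mul] at this
      linarith
    · rcases isEmpty_or_nonempty κ with hκ | ⟨⟨a⟩⟩
      · simp
      · obtain ⟨ε, hε, h⟩ := key (Pi.single a 1)
        have := h.2
        simp only [Pi.add_apply, Pi.smul_apply, smul_eq_mul, Finset.sum_add_distrib,
          ← Finset.mul_sum, Finset.sum_pi_single', Finset.mem_univ, if_true] at this
        linarith
  · refine interior_maximal (fun y hy => ⟨fun a => (hy.1 a).le, hy.2.le⟩) ?_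
    have : {y : κ → ℝ | (∀ a, 0 < y a) ∧ ∑ a, y a < 1} =
        (⋂ a, {x : κ → ℝ | 0 < x a}) ∩ {x | ∑ a, x a < 1} := by
      ext x; simp
    rw [this]
    exact (isOpen_iInter_of_finite fun a => isOpen_lt (by fun_prop) (by fun_prop)).inter
      (isOpen_lt (by fun_prop) (by fun_prop))

theorem nonempty_interior_corner : (interior (corner κ)).Nonempty := by
  rw [interior_corner]
  have h : (0 : ℝ) < Fintype.card κ + 1 := by positivity
  refine ⟨fun _ => (Fintype.card κ + 1 : ℝ)⁻¹, fun a => by positivity, ?_⟩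
  simp only [Finset.sum_const, Finset.card_univ, nsmul_eq_mul]
  rw [← div_eq_mul_inv, div_lt_one h]
  linarith

theorem mem_frontier_corner {y : κ → ℝ} (hy : y ∈ corner κ) :
    y ∈ frontier (corner κ) ↔ (∃ a, y a = 0) ∨ ∑ a, y a = 1 := by
  rw [isClosed_corner.frontier_eq, mem_sdiff, interior_corner]
  constructor
  · rintro ⟨-, h⟩
    by_contra! h'
    exact h ⟨fun a => lt_of_le_of_ne (hy.1 a) (h'.1 a).symm, lt_of_le_of_ne hy.2 h'.2⟩
  · rintro (⟨a, ha⟩ | h)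
    · exact ⟨hy, fun h' => (h'.1 a).ne' ha⟩
    · exact ⟨hy, fun h' => h'.2.ne h⟩

end Corner

/-- A prism over a coordinate simplex is a cell. -/
theorem isCell_prism {ι : Type*} {s : Finset ι} (hs : s.Nonempty) {V : Type*}
    [NormedAddCommGroup V] [NormedSpace ℝ V] [FiniteDimensional ℝ V] {J : Set V}
    (hJ : Convex ℝ J) (hJc : IsCompact J) (hJn : (interior J).Nonempty) :
    IsCell (s.card - 1 + Module.finrank ℝ V) (coordSimplex s ×ˢ J)
      (coordBoundary s ×ˢ J ∪ coordSimplex s ×ˢ frontier J) := by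
  classical
  obtain ⟨a₀, ha₀⟩ := hs
  let κ := {a // a ∈ s.erase a₀}
  have hdim : Module.finrank ℝ ((κ → ℝ) × V) = s.card - 1 + Module.finrank ℝ V := by
    rw [Module.finrank_prod, Module.finrank_fintype_fun_eq_card, Fintype.card_coe,
      Finset.card_erase_of_mem ha₀]
  have hcell := isCell_of_convex (convex_corner (κ := κ) |>.prod hJ) (isCompact_corner.prod hJc)
    (by rw [interior_prod_eq]; exact nonempty_interior_corner.prod hJn) hdim
  rw [frontier_prod_eq, hJc.isClosed.closure_eq, isClosed_corner.closure_eq] at hcell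
  -- Forgetting the coordinate `a₀` identifies the simplex with the full-dimensional corner; the
  -- lost coordinate is one minus the sum of the others.
  let P : (κ → ℝ) → ι → ℝ := fun y a =>
    if a = a₀ then 1 - ∑ b, y b else if h : a ∈ s.erase a₀ then y ⟨a, h⟩ else 0
  let Q : (ι → ℝ) → κ → ℝ := fun x b => x b
  have hP : Continuous P := by
    refine continuous_pi fun a => ?_
    simp only [P]
    split_ifs <;> fun_prop
  have hQ : Continuous Q := by unfold Q; fun_prop
  have hQsum : ∀ x : ι → ℝ, ∑ b, Q x b = ∑ a ∈ s.erase a₀, x a := fun x =>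
    Finset.sum_coe_sort (s.erase a₀) x
  have hsum : ∀ x : ι → ℝ, ∑ a ∈ s, x a = x a₀ + ∑ b, Q x b := fun x => by
    rw [hQsum]; exact (Finset.add_sum_erase s x ha₀).symm
  have hQP : ∀ y, Q (P y) = y := fun y => by
    ext b
    have := b.2
    simp only [Q, P, if_neg (Finset.ne_of_mem_erase this), dif_pos this]
    rfl
  have hPa₀ : ∀ y, P y a₀ = 1 - ∑ b, y b := fun y => by simp [P]
  have hPS : ∀ y ∈ corner κ, P y ∈ coordSimplex s := by
    intro y hy
    refine ⟨fun a => ?_, fun a ha => ?_, ?_⟩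
    · simp only [P]
      split_ifs
      · linarith [hy.2]
      · exact hy.1 _
      · exact le_rfl
    · have h1 : a ≠ a₀ := fun h => ha (h ▸ ha₀)
      have h2 : a ∉ s.erase a₀ := fun h => ha (Finset.mem_of_mem_erase h)
      simp only [P, if_neg h1, dif_neg h2]
    · rw [hsum, hQP, hPa₀]; ring
  have hQC : ∀ x ∈ coordSimplex s, Q x ∈ corner κ := by
    intro x hx
    refine ⟨fun b => hx.1 b, ?_⟩
    have := hsum x
    rw [hx.2.2] at this
    linarith [hx.1 a₀]
  have hPQ : ∀ x ∈ coordSimplex s, P (Q x) = x := by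
    intro x hx
    ext a
    simp only [P]
    split_ifs with h1 h2
    · have := hsum x
      rw [hx.2.2] at this
      rw [h1]; linarith
    · rfl
    · exact (hx.2.1 a fun h => h2 (Finset.mem_erase.2 ⟨h1, h⟩)).symm
  have hPB : ∀ y ∈ frontier (corner κ), P y ∈ coordBoundary s := by
    intro y hy
    have hyC := isClosed_corner.frontier_subset hy
    refine ⟨hPS y hyC, ?_⟩
    rcases (mem_frontier_corner hyC).1 hy with ⟨b, hb⟩ | h
    · refine ⟨b, Finset.mem_of_mem_erase b.2, ?_⟩
      have := congrFun (hQP y) b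
      rw [hb] at this
      exact this
    · exact ⟨a₀, ha₀, by rw [hPa₀, h, sub_self]⟩
  have hQB : ∀ x ∈ coordBoundary s, Q x ∈ frontier (corner κ) := by
    rintro x ⟨hx, a, ha, h0⟩
    rw [mem_frontier_corner (hQC x hx)]
    by_cases h : a = a₀
    · right
      have := hsum x
      rw [hx.2.2, show x a₀ = 0 from h ▸ h0] at this
      linarith
    · exact Or.inl ⟨⟨a, Finset.mem_erase.2 ⟨h, ha⟩⟩, h0⟩
  refine hcell.of_chart (fun q => (P q.1, q.2)) (fun q => (Q q.1, q.2)) (by fun_prop) (by fun_prop)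
    (fun q hq => ⟨hPS _ hq.1, hq.2⟩) (fun q hq => ⟨hQC _ hq.1, hq.2⟩) ?_ ?_
    (fun q hq => Prod.ext (hPQ _ hq.1) rfl) ?_
  · rintro q (hq | hq)
    · exact Or.inr ⟨hPS _ hq.1, hq.2⟩
    · exact Or.inl ⟨hPB _ hq.1, hq.2⟩
  · rintro q (hq | hq)
    · exact Or.inr ⟨hQB _ hq.1, hq.2⟩
    · exact Or.inl ⟨hQC _ hq.1, hq.2⟩
  · rintro q (hq | hq)
    · exact ⟨hq.1.1, hq.2⟩
    · exact ⟨hq.1, hJc.isClosed.frontier_subset hq.2⟩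

theorem mem_iff_of_mem_coordSimplex {ι : Type*} {s : Finset ι} {x : ι → ℝ}
    (hx : x ∈ coordSimplex s) (hx' : x ∉ coordBoundary s) (a : ι) : a ∈ s ↔ x a ≠ 0 :=
  ⟨fun ha h => hx' ⟨hx, a, ha, h⟩, fun h => by_contra fun ha => h (hx.2.1 a ha)⟩

/-! ### Induction over skeleta -/

/-- Construction of functions on a simplicial complex by induction over the skeleta. -/
theorem exists_skeletal {ι T : Type*} [Nonempty T] (K : Set (Finset ι)) (N : ℕ)
    (hN : ∀ s ∈ K, s.card ≤ N) (hK : ∀ s ∈ K, ∀ t ⊆ s, t.Nonempty → t ∈ K)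
    (R : Finset ι → ((ι → ℝ) → T) → Prop)
    (hR : ∀ s g g', (∀ x ∈ coordSimplex s, g x = g' x) → R s g → R s g')
    (hext : ∀ s ∈ K, s.Nonempty → ∀ g, (∀ t ⊂ s, t.Nonempty → R t g) →
      ∃ g', (∀ x ∈ coordBoundary s, g' x = g x) ∧ R s g') :
    ∃ g, ∀ s ∈ K, s.Nonempty → R s g := by
  classical
  suffices h : ∀ n, ∃ g, ∀ s ∈ K, s.Nonempty → s.card ≤ n → R s g by
    obtain ⟨g, hg⟩ := h N
    exact ⟨g, fun s hs hne => hg s hs hne (hN s hs)⟩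
  intro n
  induction n with
  | zero =>
    exact ⟨fun _ => Classical.arbitrary T, fun s _ hne h =>
      absurd (Finset.card_pos.2 hne) (by omega)⟩
  | succ n ih =>
    obtain ⟨g, hg⟩ := ih
    have hE : ∀ s : Finset ι, ∃ g', s ∈ K → s.card = n + 1 →
        (∀ x ∈ coordBoundary s, g' x = g x) ∧ R s g' := by
      intro s
      by_cases h : s ∈ K ∧ s.card = n + 1
      · obtain ⟨g', h1⟩ := hext s h.1 (Finset.card_pos.1 (by omega)) g fun t ht hne =>
          hg t (hK s h.1 t ht.1 hne) hne (by have := Finset.card_lt_card ht; omega)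
        exact ⟨g', fun _ _ => h1⟩
      · exact ⟨g, fun h1 h2 => absurd ⟨h1, h2⟩ h⟩
    choose E hE using hE
    let Q : (ι → ℝ) → Finset ι → Prop := fun x s =>
      s ∈ K ∧ s.card = n + 1 ∧ x ∈ coordSimplex s ∧ x ∉ coordBoundary s
    let g' : (ι → ℝ) → T := fun x => if h : ∃ s, Q x s then E h.choose x else g x
    -- A point in the open simplex `s` has support exactly `s`, so `s` is a face of every simplex
    -- containing the point. Hence open simplices of equal dimension are disjoint and the extensions
    -- `E s` do not conflict.
    have hsub : ∀ x s t, Q x s → x ∈ coordSimplex t → s ⊆ t := fun x s t h ht a ha =>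
      by_contra fun hat =>
        (mem_iff_of_mem_coordSimplex h.2.2.1 h.2.2.2 a).1 ha (ht.2.1 a hat)
    refine ⟨g', fun s hs hne hcard => ?_⟩
    rcases Nat.lt_or_ge n s.card with h | h
    · have hc : s.card = n + 1 := by omega
      refine hR s (E s) g' (fun x hx => ?_) (hE s hs hc).2
      simp only [g']
      by_cases hxb : x ∈ coordBoundary s
      · rw [(hE s hs hc).1 x hxb]
        have hno : ¬ ∃ t, Q x t := by
          rintro ⟨t, ht⟩
          have h1 := hsub x t s ht hx
          have h2 : t = s := Finset.eq_of_subset_of_card_le h1 (by rw [hc, ht.2.1])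
          exact ht.2.2.2 (h2 ▸ hxb)
        rw [dif_neg hno]
      · have hex : ∃ s, Q x s := ⟨s, hs, hc, hx, hxb⟩
        have h2 : hex.choose = s := Finset.eq_of_subset_of_card_le
          (hsub x _ s hex.choose_spec hx) (by rw [hc, hex.choose_spec.2.1])
        rw [dif_pos hex, h2]
    · refine hR s g g' (fun x hx => ?_) (hg s hs hne h)
      simp only [g']
      have hno : ¬ ∃ t, Q x t := by
        rintro ⟨t, ht⟩
        have := Finset.card_le_card (hsub x t s ht hx)
        have := ht.2.1
        omega
      rw [dif_neg hno]

/-! ### Controlled lifting over a complex -/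

section Lift
variable {X : Type u} {Y : Type v} {Z : Type w}
  [TopologicalSpace X] [TopologicalSpace Y] [MetricSpace Z]

/-- A sequence of gauges, each small enough for lifting cells at the scale of the previous one. -/
def IsLiftChain (k : ℕ) (f : C(X, Y)) (p : C(Y, Z)) (E : ℕ → Z → ℝ) : Prop :=
  ∀ n, IsGauge (E n) ∧ (∀ z, E (n + 1) z ≤ E n z / 4) ∧
    ∀ z, ∃ A : Set Z, IsBallStep k f p (Metric.ball z (E n z / 4)) A ∧
      IsBallStep k f p A (Metric.ball z (4 * E (n + 1) z)) ∧
      Metric.ball z (4 * E (n + 1) z) ⊆ A ∧ A ⊆ Metric.ball z (E n z / 4)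

/-- Each term takes two shrinkings, because `IsBallStep.exists_lift` first fills and then corrects.
The divisions by 4 leave room to compare balls with nearby centres. -/
theorem exists_isLiftChain {k : ℕ} {f : C(X, Y)} {p : C(Y, Z)} (h : IsKShapeEquivNear k f p)
    {ε : Z → ℝ} (hε : IsGauge ε) : ∃ E, E 0 = ε ∧ IsLiftChain k f p E := by
  have step : ∀ ε : {ε : Z → ℝ // IsGauge ε}, ∃ δ : {ε : Z → ℝ // IsGauge ε},
      (∀ z, δ.1 z ≤ ε.1 z / 4) ∧
      ∀ z, ∃ A : Set Z, IsBallStep k f p (Metric.ball z (ε.1 z / 4)) A ∧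
        IsBallStep k f p A (Metric.ball z (4 * δ.1 z)) ∧
        Metric.ball z (4 * δ.1 z) ⊆ A ∧ A ⊆ Metric.ball z (ε.1 z / 4) := by
    rintro ⟨ε, hε⟩
    obtain ⟨η, hη, hηε, hη'⟩ := exists_gauge_isBallStep h (hε.div (c := 4) (by norm_num))
    obtain ⟨δ, hδ, hδη, hδ'⟩ := exists_gauge_isBallStep h hη
    refine ⟨⟨fun z => δ z / 4, hδ.div (by norm_num)⟩, fun z => ?_, fun z =>
      ⟨Metric.ball z (η z), hη' z, ?_, ?_, Metric.ball_subset_ball (hηε z)⟩⟩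
    · have := hδη z
      have := hηε z
      have := hε.1 z
      simp only at *
      linarith
    · rw [show 4 * (δ z / 4) = δ z by ring]; exact hδ' z
    · rw [show 4 * (δ z / 4) = δ z by ring]; exact Metric.ball_subset_ball (hδη z)
  choose next hnext using step
  let E : ℕ → {ε : Z → ℝ // IsGauge ε} := fun n => next^[n] ⟨ε, hε⟩
  refine ⟨fun n => (E n).1, rfl, fun n => ⟨(E n).2, ?_⟩⟩
  have : E (n + 1) = next (E n) := Function.iterate_succ_apply' _ _ _
  simp only [this]
  exact hnext (E n)

theorem IsLiftChain.antitone {k : ℕ} {f : C(X, Y)} {p : C(Y, Z)} {E : ℕ → Z → ℝ}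
    (hE : IsLiftChain k f p E) {m n : ℕ} (h : m ≤ n) (z : Z) : E n z ≤ E m z := by
  refine antitone_nat_of_succ_le (f := fun n => E n z) (fun n => ?_) h
  have h1 := (hE n).2.1 z
  have h2 := (hE n).1.1 z
  linarith

variable {ι V : Type*} [NormedAddCommGroup V] [NormedSpace ℝ V]

/-- `g` lifts `ψ` through `f` over the prism `s × J`, up to the homotopy `H` when the dimension of
the prism is at most `k`. -/
structure IsLiftOver (k : ℕ) (f : C(X, Y)) (p : C(Y, Z)) (J : Set V) (ψ : (ι → ℝ) × V → Y)
    (u : (ι → ℝ) × V → X) (ρ : (ι → ℝ) → Z) (ε : Z → ℝ) (s : Finset ι) (g : (ι → ℝ) × V → X)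
    (H : ((ι → ℝ) × V) × ℝ → Y) : Prop where
  cont : ContinuousOn g (coordSimplex s ×ˢ J)
  eq : ∀ q ∈ coordSimplex s ×ˢ frontier J, g q = u q
  near : ∀ q ∈ coordSimplex s ×ˢ J, dist (p (f (g q))) (ρ q.1) < ε (ρ q.1)
  htpy : s.card - 1 + Module.finrank ℝ V ≤ k →
    ContinuousOn H ((coordSimplex s ×ˢ J) ×ˢ Icc 0 1) ∧
    (∀ q ∈ coordSimplex s ×ˢ J, H (q, 0) = f (g q)) ∧
    (∀ q ∈ coordSimplex s ×ˢ J, H (q, 1) = ψ q) ∧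
    (∀ q ∈ coordSimplex s ×ˢ frontier J, ∀ t ∈ Icc (0 : ℝ) 1, H (q, t) = ψ q) ∧
    ∀ q ∈ coordSimplex s ×ˢ J, ∀ t ∈ Icc (0 : ℝ) 1, dist (p (H (q, t))) (ρ q.1) < ε (ρ q.1)

theorem IsLiftOver.congr {k : ℕ} {f : C(X, Y)} {p : C(Y, Z)} {J : Set V} (hJ : IsClosed J)
    {ψ : (ι → ℝ) × V → Y} {u : (ι → ℝ) × V → X} {ρ : (ι → ℝ) → Z} {ε : Z → ℝ} {s : Finset ι}
    {g g' : (ι → ℝ) × V → X} {H H' : ((ι → ℝ) × V) × ℝ → Y}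
    (h : IsLiftOver k f p J ψ u ρ ε s g H) (hg : ∀ x ∈ coordSimplex s, ∀ j ∈ J, g (x, j) = g' (x, j))
    (hH : ∀ x ∈ coordSimplex s, ∀ j ∈ J, ∀ t ∈ Icc (0 : ℝ) 1,
      s.card - 1 + Module.finrank ℝ V ≤ k → H ((x, j), t) = H' ((x, j), t)) :
    IsLiftOver k f p J ψ u ρ ε s g' H' := by
  have hg1 : ∀ q ∈ coordSimplex s ×ˢ J, g' q = g q := fun q hq => (hg q.1 hq.1 q.2 hq.2).symm
  have hfr : ∀ q ∈ coordSimplex s ×ˢ frontier J, q ∈ coordSimplex s ×ˢ J := fun q hq =>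
    ⟨hq.1, hJ.frontier_subset hq.2⟩
  refine ⟨h.cont.congr hg1, fun q hq => (hg1 q (hfr q hq)).trans (h.eq q hq), fun q hq => ?_,
    fun hk => ?_⟩
  · rw [hg1 q hq]; exact h.near q hq
  · obtain ⟨h1, h2, h3, h4, h5⟩ := h.htpy hk
    have hH1 : ∀ q ∈ coordSimplex s ×ˢ J, ∀ t ∈ Icc (0 : ℝ) 1, H' (q, t) = H (q, t) :=
      fun q hq t ht => (hH q.1 hq.1 q.2 hq.2 t ht hk).symm
    refine ⟨h1.congr fun q hq => hH1 q.1 hq.1 q.2 hq.2, fun q hq => ?_, fun q hq => ?_,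
      fun q hq t ht => ?_, fun q hq t ht => ?_⟩
    · rw [hH1 q hq 0 (by simp), hg1 q hq, h2 q hq]
    · rw [hH1 q hq 1 (by simp), h3 q hq]
    · rw [hH1 q (hfr q hq) t ht, h4 q hq t ht]
    · rw [hH1 q hq t ht]; exact h5 q hq t ht

theorem IsLiftOver.mono {k : ℕ} {f : C(X, Y)} {p : C(Y, Z)} {J : Set V}
    {ψ : (ι → ℝ) × V → Y} {u : (ι → ℝ) × V → X} {ρ : (ι → ℝ) → Z} {ε ε' : Z → ℝ} {s : Finset ι}
    {g : (ι → ℝ) × V → X} {H : ((ι → ℝ) × V) × ℝ → Y}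
    (h : IsLiftOver k f p J ψ u ρ ε s g H) (hε : ∀ z, ε z ≤ ε' z) :
    IsLiftOver k f p J ψ u ρ ε' s g H :=
  ⟨h.cont, h.eq, fun q hq => (h.near q hq).trans_le (hε _), fun hk =>
    have ⟨h1, h2, h3, h4, h5⟩ := h.htpy hk
    ⟨h1, h2, h3, h4, fun q hq t ht => (h5 q hq t ht).trans_le (hε _)⟩⟩

/-- The boundary is a finite union of closed facets. The facet is empty when `s` is a vertex, a case
the hypothesis does not cover. -/
theorem continuousOn_coordBoundary {T W : Type*} [TopologicalSpace T] [TopologicalSpace W]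
    {s : Finset ι} {J : Set W} (hJ : IsClosed J) {g : (ι → ℝ) × W → T}
    (h : ∀ t ⊂ s, t.Nonempty → ContinuousOn g (coordSimplex t ×ˢ J)) :
    ContinuousOn g (coordBoundary s ×ˢ J) := by
  classical
  have : coordBoundary s ×ˢ J = ⋃ a : s, coordSimplex (s.erase a) ×ˢ J := by
    ext q
    simp [coordBoundary_eq_biUnion]
  rw [this]
  refine (locallyFinite_of_finite _).continuousOn_iUnion
    (fun a => (isClosed_coordSimplex _).prod hJ) fun a => ?_
  rcases (s.erase a).eq_empty_or_nonempty with h0 | h0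
  · have : coordSimplex (s.erase (a : ι)) = ∅ := by
      rw [h0]
      exact eq_empty_of_forall_notMem fun x hx => (nonempty_of_mem_coordSimplex hx).ne_empty rfl
    rw [this, empty_prod]
    exact continuousOn_empty _
  · exact h _ (Finset.erase_ssubset a.2) h0

theorem isClosed_coordBoundary (s : Finset ι) : IsClosed (coordBoundary s) := by
  classical
  rw [coordBoundary_eq_biUnion]
  exact isClosed_biUnion_finset fun a _ => isClosed_coordSimplex _

theorem exists_proper_face {s : Finset ι} {x : ι → ℝ} (hx : x ∈ coordBoundary s) :
    ∃ t ⊂ s, t.Nonempty ∧ x ∈ coordSimplex t := by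
  classical
  obtain ⟨hx, a, ha, h0⟩ := hx
  have := mem_coordSimplex_of_zero hx h0
  exact ⟨_, Finset.erase_ssubset ha, nonempty_of_mem_coordSimplex this, this⟩

/-- Extension of a lift over one prism. -/
theorem IsLiftOver.exists_extension [FiniteDimensional ℝ V] {k : ℕ} {f : C(X, Y)} {p : C(Y, Z)}
    {J : Set V} (hJ : Convex ℝ J) (hJc : IsCompact J) (hJn : (interior J).Nonempty)
    {ψ : (ι → ℝ) × V → Y} {u : (ι → ℝ) × V → X} {ρ : (ι → ℝ) → Z} {ε δ θ : Z → ℝ} {s : Finset ι}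
    (hs : s.Nonempty) (hdim : s.card - 1 + Module.finrank ℝ V ≤ k + 1)
    (hε : IsGauge ε) (hδ : IsGauge δ) (hδε : ∀ z, δ z ≤ ε z / 4) (hθδ : ∀ z, θ z ≤ δ z)
    (hstep : ∀ z, ∃ A : Set Z, IsBallStep k f p (Metric.ball z (ε z / 4)) A ∧
      IsBallStep k f p A (Metric.ball z (4 * δ z)) ∧
      Metric.ball z (4 * δ z) ⊆ A ∧ A ⊆ Metric.ball z (ε z / 4))
    (hψ : ContinuousOn ψ (coordSimplex s ×ˢ J)) (hu : ContinuousOn u (coordSimplex s ×ˢ frontier J))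
    (hfu : ∀ q ∈ coordSimplex s ×ˢ frontier J, f (u q) = ψ q)
    (hρ : ∀ x ∈ coordSimplex s, ∀ x' ∈ coordSimplex s, dist (ρ x') (ρ x) < θ (ρ x))
    (hψρ : ∀ q ∈ coordSimplex s ×ˢ J, dist (p (ψ q)) (ρ q.1) < θ (ρ q.1))
    (g : (ι → ℝ) × V → X) (H : ((ι → ℝ) × V) × ℝ → Y)
    (h : ∀ t ⊂ s, t.Nonempty → IsLiftOver k f p J ψ u ρ δ t g H) :
    ∃ (g' : (ι → ℝ) × V → X) (H' : ((ι → ℝ) × V) × ℝ → Y),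
      (∀ x ∈ coordBoundary s, ∀ j ∈ J, g' (x, j) = g (x, j)) ∧
      (∀ x ∈ coordBoundary s, ∀ j ∈ J, ∀ t ∈ Icc (0 : ℝ) 1,
        s.card - 1 + Module.finrank ℝ V ≤ k → H' ((x, j), t) = H ((x, j), t)) ∧
      IsLiftOver k f p J ψ u ρ ε s g' H' := by
  classical
  have hJcl := hJc.isClosed
  -- Prisms over proper faces have dimension at most `k`, so their homotopies are available as
  -- boundary data even when the prism over `s` has dimension `k + 1`.
  have hlow : ∀ t ⊂ s, t.Nonempty → t.card - 1 + Module.finrank ℝ V ≤ k := fun t ht hne => by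
    have := Finset.card_lt_card ht
    have := Finset.card_pos.2 hne
    omega
  have hS₁ : IsClosed (coordBoundary s ×ˢ J) := (isClosed_coordBoundary s).prod hJcl
  have hS₂ : IsClosed (coordSimplex s ×ˢ frontier J) :=
    (isClosed_coordSimplex s).prod isClosed_frontier
  have hbs : ∀ q ∈ coordBoundary s ×ˢ J, ∃ t ⊂ s, t.Nonempty ∧ q ∈ coordSimplex t ×ˢ J :=
    fun q hq => by
      obtain ⟨t, h1, h2, h3⟩ := exists_proper_face hq.1
      exact ⟨t, h1, h2, h3, hq.2⟩
  -- the boundary data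
  obtain ⟨a, ha, ha1, ha2⟩ := exists_glue
    (D := coordBoundary s ×ˢ J ∪ coordSimplex s ×ˢ frontier J) (s₁ := coordBoundary s ×ˢ J)
    (s₂ := coordSimplex s ×ˢ frontier J) (f₁ := g) (f₂ := u)
    ((hS₁.union hS₂).inter hS₁) ((hS₁.union hS₂).inter hS₂) subset_rfl
    ((continuousOn_coordBoundary hJcl fun t ht hne => (h t ht hne).cont).mono inter_subset_right)
    (hu.mono inter_subset_right)
    (by
      intro q _ h1 h2
      obtain ⟨t, ht, hne, h3⟩ := hbs q h1
      exact (h t ht hne).eq q ⟨h3.1, h2.2⟩)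
  have hassoc : ContinuousOn H ((coordBoundary s ×ˢ J) ×ˢ Icc 0 1) := by
    have : ContinuousOn (fun q : (ι → ℝ) × (V × ℝ) => H ((q.1, q.2.1), q.2.2))
        (coordBoundary s ×ˢ (J ×ˢ Icc (0 : ℝ) 1)) :=
      continuousOn_coordBoundary (hJcl.prod isClosed_Icc) fun t ht hne =>
        ((h t ht hne).htpy (hlow t ht hne)).1.comp (by fun_prop)
          fun q hq => ⟨⟨hq.1, hq.2.1⟩, hq.2.2⟩
    exact this.comp (f := fun q : ((ι → ℝ) × V) × ℝ => (q.1.1, (q.1.2, q.2))) (by fun_prop)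
      fun q hq => ⟨hq.1.1, hq.1.2, hq.2⟩
  have hfrJ : coordSimplex s ×ˢ frontier J ⊆ coordSimplex s ×ˢ J :=
    prod_mono subset_rfl hJcl.frontier_subset
  have hI : IsClosed (Icc (0 : ℝ) 1) := isClosed_Icc
  obtain ⟨b, hb, hb1, hb2⟩ := exists_glue
    (D := (coordBoundary s ×ˢ J ∪ coordSimplex s ×ˢ frontier J) ×ˢ Icc (0 : ℝ) 1)
    (s₁ := (coordBoundary s ×ˢ J) ×ˢ Icc (0 : ℝ) 1)
    (s₂ := (coordSimplex s ×ˢ frontier J) ×ˢ Icc (0 : ℝ) 1) (f₁ := H) (f₂ := fun q => ψ q.1)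
    (((hS₁.union hS₂).prod hI).inter (hS₁.prod hI)) (((hS₁.union hS₂).prod hI).inter (hS₂.prod hI))
    (by rw [union_prod])
    (hassoc.mono inter_subset_right)
    (hψ.comp continuousOn_fst fun q hq => hfrJ hq.2.1)
    (by
      intro q _ h1 h2
      obtain ⟨t, ht, hne, h3⟩ := hbs q.1 h1.1
      exact ((h t ht hne).htpy (hlow t ht hne)).2.2.2.1 q.1 ⟨h3.1, h2.1.2⟩ q.2 h2.2)
  obtain ⟨x₀, hx₀⟩ : (coordSimplex s).Nonempty := by
    obtain ⟨a, ha⟩ := hs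
    refine ⟨Pi.single a 1, fun b => ?_, fun b hb => ?_, ?_⟩
    · by_cases h : b = a
      · subst h; simp
      · simp [Pi.single_eq_of_ne h]
    · exact Pi.single_eq_of_ne (fun h => hb (by rw [h]; exact ha)) _
    · rw [Finset.sum_pi_single']; simp [ha]
  -- One centre serves the whole prism: by the Lipschitz property, `δ`-closeness to any `ρ x` places
  -- a point within `3 δ c` of `c`, and lying within `ε c / 4` of `c` gives `ε`-closeness to every
  -- `ρ x`.
  set c := ρ x₀ with hc
  obtain ⟨A, hA1, hA2, hA3, hA4⟩ := hstep c
  have hin : ∀ x ∈ coordSimplex s, ∀ z, dist z (ρ x) < δ (ρ x) → z ∈ Metric.ball c (4 * δ c) := by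
    intro x hx z hz
    rw [Metric.mem_ball]
    have h1 := hρ x₀ hx₀ x hx
    have h2 := hδ.2 (ρ x) c
    have h3 := hθδ c
    have h4 := dist_triangle z (ρ x) c
    have h5 := hδ.1 c
    linarith
  have hout : ∀ x ∈ coordSimplex s, ∀ z ∈ Metric.ball c (ε c / 4), dist z (ρ x) < ε (ρ x) := by
    intro x hx z hz
    rw [Metric.mem_ball] at hz
    have h1 := hρ x₀ hx₀ x hx
    have h2 := hε.2 c (ρ x)
    rw [dist_comm] at h2
    have h3 := hθδ c
    have h4 := dist_triangle z c (ρ x)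
    rw [dist_comm c] at h4
    have h5 := hε.1 c
    have h6 := hδε c
    linarith
  have hbd : ∀ q ∈ coordBoundary s ×ˢ J ∪ coordSimplex s ×ˢ frontier J, q ∈ coordSimplex s ×ˢ J := by
    rintro q (hq | hq)
    · exact ⟨hq.1.1, hq.2⟩
    · exact hfrJ hq
  obtain ⟨g', H', hg', hg'a, hg'A, hH'⟩ := hA1.exists_cell_lift hA2 hA3 hA4 hdim
    (isCell_prism hs hJ hJc hJn) a b ψ ha hb hψ
    (by
      rintro q (hq | hq)
      · obtain ⟨t, ht, hne, h3⟩ := hbs q hq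
        rw [hb1 (q, 0) ⟨Or.inl hq, by simp⟩ ⟨hq, by simp⟩, ha1 q (Or.inl hq) hq]
        exact ((h t ht hne).htpy (hlow t ht hne)).2.1 q h3
      · rw [hb2 (q, 0) ⟨Or.inr hq, by simp⟩ ⟨hq, by simp⟩, ha2 q (Or.inr hq) hq]
        exact (hfu q hq).symm)
    (by
      rintro q (hq | hq)
      · obtain ⟨t, ht, hne, h3⟩ := hbs q hq
        rw [hb1 (q, 1) ⟨Or.inl hq, by simp⟩ ⟨hq, by simp⟩]
        exact ((h t ht hne).htpy (hlow t ht hne)).2.2.1 q h3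
      · rw [hb2 (q, 1) ⟨Or.inr hq, by simp⟩ ⟨hq, by simp⟩])
    (by
      rintro q hq' r hr
      have hqJ := hbd q hq'
      rcases hq' with hq | hq
      · obtain ⟨t, ht, hne, h3⟩ := hbs q hq
        rw [hb1 (q, r) ⟨Or.inl hq, hr⟩ ⟨hq, hr⟩]
        exact hin q.1 hqJ.1 _ (((h t ht hne).htpy (hlow t ht hne)).2.2.2.2 q h3 r hr)
      · rw [hb2 (q, r) ⟨Or.inr hq, hr⟩ ⟨hq, hr⟩]
        exact hin q.1 hqJ.1 _ ((hψρ q hqJ).trans_le (hθδ _)))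
    (fun q hq => hin q.1 hq.1 _ ((hψρ q hq).trans_le (hθδ _)))
  refine ⟨g', H', fun x hx j hj => ?_, fun x hx j hj t ht hk => ?_, ?_⟩
  · have hq : (x, j) ∈ coordBoundary s ×ˢ J := ⟨hx, hj⟩
    rw [hg'a _ (Or.inl hq), ha1 _ (Or.inl hq) hq]
  · have hq : (x, j) ∈ coordBoundary s ×ˢ J := ⟨hx, hj⟩
    rw [(hH' hk).2.2.2.1 _ (Or.inl hq) t ht, hb1 _ ⟨Or.inl hq, ht⟩ ⟨hq, ht⟩]
  · refine ⟨hg', fun q hq => ?_, fun q hq => hout _ hq.1 _ (hg'A q hq), fun hk => ?_⟩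
    · rw [hg'a _ (Or.inr hq), ha2 _ (Or.inr hq) hq]
    · obtain ⟨h1, h2, h3, h4, h5⟩ := hH' hk
      refine ⟨h1, h2, h3, fun q hq t ht => ?_, fun q hq t ht => hout _ hq.1 _ (h5 q hq t ht)⟩
      rw [h4 _ (Or.inr hq) t ht, hb2 _ ⟨Or.inr hq, ht⟩ ⟨hq, ht⟩]

/-- Lifting over a complex. -/
theorem IsLiftChain.exists_isLiftOver [FiniteDimensional ℝ V] {k : ℕ} {f : C(X, Y)} {p : C(Y, Z)}
    {E : ℕ → Z → ℝ} (hE : IsLiftChain k f p E) [Nonempty X] {J : Set V} (hJ : Convex ℝ J)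
    (hJc : IsCompact J) (hJn : (interior J).Nonempty) (K : Set (Finset ι))
    (hN : ∀ s ∈ K, s.card ≤ k + 1) (hdim : ∀ s ∈ K, s.card - 1 + Module.finrank ℝ V ≤ k + 1)
    (hK : ∀ s ∈ K, ∀ t ⊆ s, t.Nonempty → t ∈ K)
    {ψ : (ι → ℝ) × V → Y} {u : (ι → ℝ) × V → X} {ρ : (ι → ℝ) → Z}
    (hψ : ∀ s ∈ K, ContinuousOn ψ (coordSimplex s ×ˢ J))
    (hu : ∀ s ∈ K, ContinuousOn u (coordSimplex s ×ˢ frontier J))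
    (hfu : ∀ s ∈ K, ∀ q ∈ coordSimplex s ×ˢ frontier J, f (u q) = ψ q)
    (hρ : ∀ s ∈ K, ∀ x ∈ coordSimplex s, ∀ x' ∈ coordSimplex s,
      dist (ρ x') (ρ x) < E (k + 1) (ρ x))
    (hψρ : ∀ s ∈ K, ∀ q ∈ coordSimplex s ×ˢ J, dist (p (ψ q)) (ρ q.1) < E (k + 1) (ρ q.1)) :
    ∃ (g : (ι → ℝ) × V → X) (H : ((ι → ℝ) × V) × ℝ → Y), ∀ s ∈ K, s.Nonempty →
      IsLiftOver k f p J ψ u ρ (E 0) s g H := by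
  classical
  have : Nonempty Y := (inferInstance : Nonempty X).map f
  -- The values of the skeletal function are whole fibres of the lift and homotopy over a point of
  -- the simplex. Simplices with `m` vertices are treated at scale `E (k + 1 - m)`, so each
  -- dimension moves one term up the chain, from `E (k + 1)` to at most `E 0`.
  obtain ⟨G, hG⟩ := exists_skeletal (T := (V → X) × (V × ℝ → Y)) K (k + 1) hN hK
    (fun s G => s ∈ K → IsLiftOver k f p J ψ u ρ (E (k + 1 - s.card)) s
      (fun q => (G q.1).1 q.2) (fun q => (G q.1.1).2 (q.1.2, q.2)))
    (fun s G G' h h' hs => (h' hs).congr hJc.isClosed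
      (fun x hx j _ => by simp only [h x hx]) (fun x hx j _ t _ _ => by simp only [h x hx]))
    (by
      intro s hs hne G hG
      have hcard := Finset.card_pos.2 hne
      have hcard' := hN s hs
      obtain ⟨h1, h2, h3⟩ := hE (k + 1 - s.card)
      obtain ⟨g', H', hg', hH', hl⟩ := IsLiftOver.exists_extension hJ hJc hJn hne (hdim s hs) h1
        (hE _).1 h2 (hE.antitone (by omega)) h3 (hψ s hs) (hu s hs) (hfu s hs) (hρ s hs) (hψρ s hs)
        (fun q => (G q.1).1 q.2) (fun q => (G q.1.1).2 (q.1.2, q.2))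
        (fun t ht htne => by
          have := Finset.card_lt_card ht
          exact (hG t ht htne (hK s hs t ht.1 htne)).mono (hE.antitone (by omega)))
      -- The extension agrees with `G` only over `J` and `[0, 1]`; resetting it on the boundary
      -- makes the agreement an equality of functions.
      refine ⟨fun x => if x ∈ coordBoundary s then G x else
        (fun j => g' (x, j), fun q => H' ((x, q.1), q.2)), fun x hx => if_pos hx, fun _ => ?_⟩
      refine hl.congr hJc.isClosed (fun x hx j hj => ?_) fun x hx j hj t ht hk => ?_
      · by_cases h : x ∈ coordBoundary s
        · simp only [if_pos h]; exact hg' x h j hj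
        · simp only [if_neg h]
      · by_cases h : x ∈ coordBoundary s
        · simp only [if_pos h]; exact hH' x h j hj t ht hk
        · simp only [if_neg h])
  exact ⟨_, _, fun s hs hne => (hG s hs hne hs).mono (hE.antitone (Nat.zero_le _))⟩

end Lift

/-! ### Nerves, and domination of ANRs by complexes -/

theorem mem_coordSimplex_finsupport {ι Y : Type*} [TopologicalSpace Y]
    (φ : PartitionOfUnity ι Y univ) (y : Y) : (fun a => φ a y) ∈ coordSimplex (φ.finsupport y) :=
  ⟨fun a => φ.nonneg a y, fun a ha => by simpa using ha, φ.sum_finsupport (mem_univ y)⟩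

/-- A function continuous on the prisms of a complex becomes continuous after composition with the
canonical map given by a partition of unity. -/
theorem continuousOn_comp_partition {ι Y W T : Type*} [TopologicalSpace Y] [TopologicalSpace W]
    [TopologicalSpace T] (φ : PartitionOfUnity ι Y univ) (K : Set (Finset ι))
    (hφ : ∀ y, φ.finsupport y ∈ K) {J : Set W} (hJ : IsClosed J) {g : (ι → ℝ) × W → T}
    (hg : ∀ s ∈ K, s.Nonempty → ContinuousOn g (coordSimplex s ×ˢ J)) :
    ContinuousOn (fun q : Y × W => g (fun a => φ a q.1, q.2)) (univ ×ˢ J) := by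
  classical
  rintro ⟨y, j⟩ hyj
  obtain ⟨F, hF⟩ := φ.exists_finset_nhds y
  let N : Set Y := {y' | Function.support (φ · y') ⊆ F}
  have hN : N ∈ 𝓝 y := hF.mono fun y' h => h.2
  -- Near `y` only the finitely many simplices with vertices in `F` occur. They are closed, so
  -- continuity on each suffices, and the whole complex needs no topology of its own.
  let S := {s : Finset ι // s ⊆ F ∧ s ∈ K ∧ s.Nonempty}
  have : Finite S := by
    refine Finite.of_injective (fun s : S => (⟨s.1, Finset.mem_powerset.2 s.2.1⟩ : F.powerset)) ?_
    intro s t h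
    exact Subtype.ext (congrArg (fun q : F.powerset => q.1) h)
  have hcont : ContinuousOn g (⋃ s : S, coordSimplex s.1 ×ˢ J) :=
    (locallyFinite_of_finite _).continuousOn_iUnion
      (fun s => (isClosed_coordSimplex _).prod hJ) fun s => hg _ s.2.2.1 s.2.2.2
  have hφc : Continuous fun q : Y × W => ((fun a => φ a q.1 : ι → ℝ), q.2) := by fun_prop
  have hcomp : ContinuousOn (fun q : Y × W => g (fun a => φ a q.1, q.2)) (N ×ˢ J) := by
    refine hcont.comp hφc.continuousOn fun q hq => ?_
    have hmem := mem_coordSimplex_finsupport φ q.1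
    refine mem_iUnion.2 ⟨⟨φ.finsupport q.1, fun a ha => ?_, hφ _,
      nonempty_of_mem_coordSimplex hmem⟩, hmem, hq.2⟩
    exact hq.1 (by simpa using ha)
  refine (hcomp _ ⟨mem_of_mem_nhds hN, hyj.2⟩).mono_of_mem_nhdsWithin ?_
  refine Filter.mem_of_superset (inter_mem_nhdsWithin _ (prod_mem_nhds hN Filter.univ_mem)) ?_
  rintro q ⟨h1, h2⟩
  exact ⟨h2.1, h1.2⟩

/-- The Kuratowski embedding into bounded continuous functions. -/
noncomputable def distEmbedding {Y : Type*} [MetricSpace Y] (y₀ y : Y) :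
    BoundedContinuousFunction Y ℝ :=
  BoundedContinuousFunction.mkOfBound ⟨fun w => dist y w - dist y₀ w, by fun_prop⟩
    (2 * dist y y₀) fun a b => by
      have h := abs_dist_sub_le y y₀ a
      have h' := abs_dist_sub_le y y₀ b
      rw [abs_le] at h h'
      simp only [ContinuousMap.coe_mk, Real.dist_eq, abs_le]
      constructor <;> linarith

theorem isometry_distEmbedding {Y : Type*} [MetricSpace Y] (y₀ : Y) :
    Isometry (distEmbedding y₀) := by
  refine Isometry.of_dist_eq fun y y' => le_antisymm ?_ ?_
  · refine (BoundedContinuousFunction.dist_le dist_nonneg).2 fun w => ?_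
    have := abs_dist_sub_le y y' w
    simpa [distEmbedding, Real.dist_eq] using this
  · have := BoundedContinuousFunction.dist_coe_le_dist (f := distEmbedding y₀ y)
      (g := distEmbedding y₀ y') y'
    simpa [distEmbedding, Real.dist_eq] using this

/-- A compact neighbourhood has closed image, so near a point of the range the closure adds nothing.
-/
theorem isLocallyClosed_range_of_isEmbedding {Y M : Type*} [TopologicalSpace Y]
    [LocallyCompactSpace Y] [TopologicalSpace M] [T2Space M] {e : Y → M} (he : IsEmbedding e) :
    IsLocallyClosed (range e) := by
  refine ((isLocallyClosed_tfae (range e)).out 0 3).2 ?_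
  rintro _ ⟨y, rfl⟩
  obtain ⟨N, hN, hyN⟩ := exists_compact_mem_nhds y
  rw [he.nhds_eq_comap] at hyN
  obtain ⟨O, hO, hON⟩ := Filter.mem_comap.1 hyN
  obtain ⟨O', hO', hO'o, hy⟩ := mem_nhds_iff.1 hO
  refine ⟨O', hy, hO'o, ?_⟩
  have h1 : O' ∩ range e ⊆ e '' N := by
    rintro _ ⟨h, y', rfl⟩
    exact ⟨y', hON (hO' h), rfl⟩
  calc O' ∩ closure (range e) ⊆ closure (O' ∩ range e) := hO'o.inter_closure
    _ ⊆ e '' N := closure_minimal h1 (hN.image he.continuous).isClosed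
    _ ⊆ range e := image_subset_range _ _

/-- A locally compact ANR is a retract of an open subset of a normed space. -/
theorem IsANR.exists_retraction {Y : Type v} [MetricSpace Y] [LocallyCompactSpace Y] [Nonempty Y]
    (hY : IsANR Y) : ∃ (e : Y → BoundedContinuousFunction Y ℝ)
      (r : BoundedContinuousFunction Y ℝ → Y) (O : Set (BoundedContinuousFunction Y ℝ)),
      Isometry e ∧ IsOpen O ∧ (∀ y, e y ∈ O) ∧ ContinuousOn r O ∧ ∀ y, r (e y) = y := by
  let y₀ : Y := Classical.arbitrary Y
  have he := isometry_distEmbedding y₀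
  set e := distEmbedding y₀
  have hlc := isLocallyClosed_range_of_isEmbedding he.isEmbedding
  -- The coborder is the largest set in which the range is closed, and it is open because the range
  -- is locally closed. Thus a neighbourhood retract inside it is one in the normed space.
  have hmem : ∀ y, e y ∈ coborder (range e) := fun y => subset_coborder ⟨y, rfl⟩
  let e' : Y → coborder (range e) := fun y => ⟨e y, hmem y⟩
  have he' : IsClosedEmbedding e' := by
    refine ⟨he.isEmbedding.codRestrict _ hmem, ?_⟩
    have : range e' = Subtype.val ⁻¹' range e := by
      ext ⟨z, hz⟩
      simp [e', Subtype.ext_iff]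
    rw [this]
    exact isClosed_preimage_val_coborder
  obtain ⟨U, hU, hUe, r, hr⟩ := hY.2 (coborder (range e)) e' he'
  have hO : IsOpen (Subtype.val '' U) := hlc.isOpen_coborder.isOpenMap_subtype_val U hU
  obtain ⟨R, hR, hRr⟩ := exists_continuousOn_extension
    (s := (Subtype.val '' U : Set (BoundedContinuousFunction Y ℝ)))
    (fun z => r ⟨⟨z.1, by obtain ⟨w, -, hw⟩ := z.2; rw [← hw]; exact w.2⟩, by
      obtain ⟨w, hwU, hw⟩ := z.2
      have hzw : ∀ h, (⟨z.1, h⟩ : coborder (range e)) = w := fun h => Subtype.ext hw.symm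
      rw [hzw]
      exact hwU⟩) (by fun_prop)
  refine ⟨e, R, Subtype.val '' U, he, hO, fun y => ⟨e' y, hUe y, rfl⟩, hR, fun y => ?_⟩
  exact (hRr ⟨e y, e' y, hUe y, rfl⟩).trans (hr y)

/-- Partitions of unity subordinate to a cover of bounded order. -/
theorem CoveringDimLE.exists_partition {Y : Type v} [TopologicalSpace Y] [NormalSpace Y]
    [ParacompactSpace Y] {k : ℕ} (hd : CoveringDimLE k Y) (W : Y → Set Y)
    (hW : ∀ y, IsOpen (W y)) (hyW : ∀ y, y ∈ W y) :
    ∃ (ι : Type v) (φ : PartitionOfUnity ι Y univ) (U : ι → Set Y) (c : ι → Y),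
      (∀ a y, φ a y ≠ 0 → y ∈ U a) ∧ (∀ a, U a ⊆ W (c a)) ∧
      ∀ y, {a | y ∈ U a}.encard ≤ k + 1 := by
  obtain ⟨𝒱, h1, h2, h3, h4⟩ := hd (range W) (by rintro _ ⟨y, rfl⟩; exact hW y)
    (eq_univ_of_forall fun y => ⟨W y, ⟨y, rfl⟩, hyW y⟩)
  have h3' : ∀ V : 𝒱, ∃ y, V.1 ⊆ W y := fun V => by
    obtain ⟨_, ⟨y, rfl⟩, h⟩ := h3 V.1 V.2
    exact ⟨y, h⟩
  choose c hc using h3'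
  obtain ⟨φ, hφ⟩ := PartitionOfUnity.exists_isSubordinate isClosed_univ (fun V : 𝒱 => V.1)
    (fun V => h1 V.1 V.2) (by rw [← sUnion_eq_iUnion, h2])
  refine ⟨𝒱, φ, fun V => V.1, c, fun a y hy => hφ a (subset_tsupport _ hy), hc, fun y => ?_⟩
  refine le_trans ?_ (h4 y)
  rw [← Subtype.val_injective.encard_image]
  refine encard_le_encard ?_
  rintro _ ⟨V, hV, rfl⟩
  exact ⟨V.2, hV⟩

/-- Map the nerve of a fine cover linearly into the normed space and retract. When all vertices of a
simplex come from cover members containing `y`, convexity keeps the simplex in a small ball about `e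
y`, where the retraction is defined and controlled. The segment from `e y` to the nerve point,
retracted, is the homotopy `D`. -/
theorem IsANR.exists_domination_of_metric {Y : Type v} {Z : Type w} [MetricSpace Y]
    [LocallyCompactSpace Y] [Nonempty Y] [MetricSpace Z] (hY : IsANR Y) {k : ℕ}
    (hd : CoveringDimLE k Y) (ρ : C(Y, Z)) {θ : Z → ℝ} (hθ : IsGauge θ) :
    ∃ (ι : Type v) (φ : PartitionOfUnity ι Y univ) (K : Set (Finset ι)) (ψ : (ι → ℝ) → Y)
      (D : Y × ℝ → Y), (∀ s ∈ K, s.card ≤ k + 1) ∧ (∀ s ∈ K, ∀ t ⊆ s, t.Nonempty → t ∈ K) ∧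
      (∀ y, φ.finsupport y ∈ K) ∧ (∀ s ∈ K, ContinuousOn ψ (coordSimplex s)) ∧
      (∀ s ∈ K, ∀ x ∈ coordSimplex s, ∀ x' ∈ coordSimplex s,
        dist (ρ (ψ x')) (ρ (ψ x)) < θ (ρ (ψ x))) ∧
      ContinuousOn D (univ ×ˢ Icc 0 1) ∧ (∀ y, D (y, 0) = y) ∧
      (∀ y, D (y, 1) = ψ fun a => φ a y) ∧
      ∀ y, ∀ t ∈ Icc (0 : ℝ) 1, dist (ρ (D (y, t))) (ρ y) < θ (ρ y) := by
  obtain ⟨e, r, O, he, hO, heO, hr, hre⟩ := hY.exists_retraction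
  obtain ⟨δ, hδ, hδQ⟩ := exists_gauge (Z := Y) (fun y s => Metric.ball (e y) s ⊆ O ∧
      ∀ v ∈ Metric.ball (e y) s, dist (ρ (r v)) (ρ y) < θ (ρ y) / 4)
    (fun y s s' _ hs h => ⟨(Metric.ball_subset_ball hs).trans h.1,
      fun v hv => h.2 v (Metric.ball_subset_ball hs hv)⟩)
    (fun y => by
      have hOn : O ∈ 𝓝 (e y) := hO.mem_nhds (heO y)
      have h1 : ∀ᶠ v in 𝓝 (e y), dist (ρ (r v)) (ρ y) < θ (ρ y) / 16 := by
        have hc : ContinuousAt (fun v => dist (ρ (r v)) (ρ y)) (e y) :=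
          (ρ.continuous.continuousAt.comp (hr.continuousAt hOn)).dist continuousAt_const
        have h0 : dist (ρ (r (e y))) (ρ y) < θ (ρ y) / 16 := by
          rw [hre, dist_self]; linarith [hθ.1 (ρ y)]
        exact hc.eventually (gt_mem_nhds h0)
      obtain ⟨s, hs, hsO⟩ := Metric.eventually_nhds_iff_ball.1 (h1.and hOn)
      refine ⟨s / 2, half_pos hs, fun y' hy' => ?_⟩
      have hsub : Metric.ball (e y') (s / 2) ⊆ Metric.ball (e y) s := by
        refine Metric.ball_subset_ball' ?_
        rw [he.dist_eq]; linarith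
      refine ⟨fun v hv => (hsO v (hsub hv)).2, fun v hv => ?_⟩
      have h2 := (hsO v (hsub hv)).1
      have h3 := (hsO (e y') (by rw [Metric.mem_ball, he.dist_eq]; linarith)).1
      rw [hre] at h3
      have h4 := dist_triangle_right (ρ (r v)) (ρ y') (ρ y)
      have h5 := hθ.2 (ρ y) (ρ y')
      rw [dist_comm] at h5
      linarith [hθ.1 (ρ y)])
  have hQ : ∀ y, ∀ v ∈ Metric.ball (e y) (δ y), dist (ρ (r v)) (ρ y) < θ (ρ y) / 4 :=
    fun y => (hδQ y).2
  -- Radius `δ / 4` suffices: if `y` is in the ball about `c a`, the Lipschitz property puts `c a`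
  -- within `δ y` of `y`.
  obtain ⟨ι, φ, U, c, hφU, hUc, hcard⟩ := hd.exists_partition
    (fun y => Metric.ball y (δ y / 4)) (fun y => Metric.isOpen_ball)
    (fun y => Metric.mem_ball_self (by linarith [hδ.1 y]))
  have hc : ∀ a y, y ∈ U a → e (c a) ∈ Metric.ball (e y) (δ y) := by
    intro a y hy
    have h1 := hUc a hy
    rw [Metric.mem_ball] at h1
    rw [Metric.mem_ball, he.dist_eq, dist_comm]
    have h2 := hδ.2 (c a) y
    rw [dist_comm] at h2
    linarith [hδ.1 (c a)]
  let Ψ : (ι → ℝ) → BoundedContinuousFunction Y ℝ := fun x => ∑ᶠ a, x a • e (c a)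
  have hΨ : ∀ (s : Finset ι), ∀ x ∈ coordSimplex s, Ψ x = ∑ a ∈ s, x a • e (c a) := by
    intro s x hx
    refine finsum_eq_sum_of_support_subset _ fun a ha => ?_
    by_contra h
    exact ha (by simp [hx.2.1 a h])
  have hΨb : ∀ (s : Finset ι) (y : Y), (∀ a ∈ s, y ∈ U a) → ∀ x ∈ coordSimplex s,
      Ψ x ∈ Metric.ball (e y) (δ y) := by
    intro s y hy x hx
    rw [hΨ s x hx]
    exact (convex_ball _ _).sum_mem (fun a _ => hx.1 a) hx.2.2 fun a ha => hc a y (hy a ha)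
  have hsupp : ∀ y, ∀ a ∈ φ.finsupport y, y ∈ U a := fun y a ha => hφU a y (by simpa using ha)
  have hDb : ∀ y, ∀ t ∈ Icc (0 : ℝ) 1,
      (1 - t) • e y + t • Ψ (fun a => φ a y) ∈ Metric.ball (e y) (δ y) := fun y t ht =>
    convex_ball _ _ (Metric.mem_ball_self (hδ.1 y))
      (hΨb _ y (hsupp y) _ (mem_coordSimplex_finsupport φ y)) (by linarith [ht.2]) ht.1 (by ring)
  -- The complex is the nerve: its simplices are sets of indices whose cover members have a common
  -- point.
  refine ⟨ι, φ, {s | ∃ y, ∀ a ∈ s, y ∈ U a}, fun x => r (Ψ x),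
    fun q => r ((1 - q.2) • e q.1 + q.2 • Ψ (fun a => φ a q.1)), ?_, ?_, fun y => ⟨y, hsupp y⟩,
    ?_, ?_, ?_, fun y => ?_, fun y => ?_, fun y t ht => ?_⟩
  · rintro s ⟨y, hy⟩
    have h1 : (s : Set ι) ⊆ {a | y ∈ U a} := fun a ha => hy a ha
    have h2 := (encard_le_encard h1).trans (hcard y)
    rw [encard_coe_eq_coe_finsetCard] at h2
    exact_mod_cast h2
  · rintro s ⟨y, hy⟩ t ht -
    exact ⟨y, fun a ha => hy a (ht ha)⟩
  · rintro s ⟨y, hy⟩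
    refine hr.comp ?_ fun x hx => (hδQ y).1 (hΨb s y hy x hx)
    have : Continuous fun x : ι → ℝ => ∑ a ∈ s, x a • e (c a) := by fun_prop
    exact this.continuousOn.congr (hΨ s)
  · rintro s ⟨y, hy⟩ x hx x' hx'
    have h1 := hQ y _ (hΨb s y hy x hx)
    have h2 := hQ y _ (hΨb s y hy x' hx')
    have h3 := dist_triangle_right (ρ (r (Ψ x'))) (ρ (r (Ψ x))) (ρ y)
    have h4 := hθ.2 (ρ y) (ρ (r (Ψ x)))
    rw [dist_comm] at h4
    linarith [hθ.1 (ρ y)]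
  · have h1 : Continuous fun y => Ψ fun a => φ a y :=
      φ.continuous_finsum_smul (g := fun a _ => e (c a)) fun a x _ => continuousAt_const
    have h2 := he.continuous
    have h3 : Continuous fun q : Y × ℝ => (1 - q.2) • e q.1 + q.2 • Ψ (fun a => φ a q.1) :=
      ((continuous_const.sub continuous_snd).smul (h2.comp continuous_fst)).add
        (continuous_snd.smul (h1.comp continuous_fst))
    exact hr.comp h3.continuousOn fun q hq => (hδQ q.1).1 (hDb q.1 q.2 hq.2)
  · simp [hre]
  · simp
  · exact (hQ y _ (hDb y t ht)).trans (div_lt_self (hθ.1 (ρ y)) (by norm_num))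

/-- A locally compact ANR of dimension at most `k` is dominated, with small control, by a complex of
dimension at most `k`. -/
theorem IsANR.exists_domination {Y : Type v} {Z : Type w} [TopologicalSpace Y]
    [LocallyCompactSpace Y] [Nonempty Y] [MetricSpace Z] (hY : IsANR Y) {k : ℕ}
    (hd : CoveringDimLE k Y) (ρ : C(Y, Z)) {θ : Z → ℝ} (hθ : IsGauge θ) :
    ∃ (ι : Type v) (φ : PartitionOfUnity ι Y univ) (K : Set (Finset ι)) (ψ : (ι → ℝ) → Y)
      (D : Y × ℝ → Y), (∀ s ∈ K, s.card ≤ k + 1) ∧ (∀ s ∈ K, ∀ t ⊆ s, t.Nonempty → t ∈ K) ∧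
      (∀ y, φ.finsupport y ∈ K) ∧ (∀ s ∈ K, ContinuousOn ψ (coordSimplex s)) ∧
      (∀ s ∈ K, ∀ x ∈ coordSimplex s, ∀ x' ∈ coordSimplex s,
        dist (ρ (ψ x')) (ρ (ψ x)) < θ (ρ (ψ x))) ∧
      ContinuousOn D (univ ×ˢ Icc 0 1) ∧ (∀ y, D (y, 0) = y) ∧
      (∀ y, D (y, 1) = ψ fun a => φ a y) ∧
      ∀ y, ∀ t ∈ Icc (0 : ℝ) 1, dist (ρ (D (y, t))) (ρ y) < θ (ρ y) := by
  have := hY.1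
  let m := TopologicalSpace.metrizableSpaceMetric Y
  exact hY.exists_domination_of_metric hd ρ hθ

/-! ### Controlled homotopies and homotopy inverses -/

section Homotopy
variable {A : Type u} {B : Type v} {Z : Type w} [TopologicalSpace A] [TopologicalSpace B]
  [MetricSpace Z]

/-- The tracks of the homotopy stay `r`-close to a given map. -/
def IsCloseHomotopy (q : A → Z) (b : B → Z) (r : A → ℝ) {f g : C(A, B)} (H : f.Homotopy g) : Prop :=
  ∀ (t : I) (x : A), dist (b (H (t, x))) (q x) < r x

theorem IsCloseHomotopy.trans {q : A → Z} {b : B → Z} {r : A → ℝ} {f g h : C(A, B)}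
    {H : f.Homotopy g} {G : g.Homotopy h} (hH : IsCloseHomotopy q b r H)
    (hG : IsCloseHomotopy q b r G) : IsCloseHomotopy q b r (H.trans G) := by
  intro t x
  rw [ContinuousMap.Homotopy.trans_apply]
  split_ifs
  · exact hH _ x
  · exact hG _ x

theorem IsCloseHomotopy.symm {q : A → Z} {b : B → Z} {r : A → ℝ} {f g : C(A, B)}
    {H : f.Homotopy g} (hH : IsCloseHomotopy q b r H) : IsCloseHomotopy q b r H.symm :=
  fun t x => hH (σ t) x

theorem exists_homotopy_of_continuousOn {f g : C(A, B)} (h : A × ℝ → B)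
    (hc : ContinuousOn h (univ ×ˢ Icc 0 1)) (h0 : ∀ x, h (x, 0) = f x) (h1 : ∀ x, h (x, 1) = g x)
    {q : A → Z} {b : B → Z} {r : A → ℝ}
    (hr : ∀ x, ∀ t ∈ Icc (0 : ℝ) 1, dist (b (h (x, t))) (q x) < r x) :
    ∃ H : f.Homotopy g, IsCloseHomotopy q b r H := by
  refine ⟨⟨⟨fun y => h (y.2, y.1), ?_⟩, fun x => h0 x, fun x => h1 x⟩, fun t x => hr x t t.2⟩
  exact continuousOn_univ.1 (hc.comp (by fun_prop) fun y _ => ⟨mem_univ _, y.1.2⟩)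

end Homotopy

section Inverse
variable {X : Type u} {Y : Type v} {Z : Type w}
  [TopologicalSpace X] [TopologicalSpace Y] [MetricSpace Z] {k : ℕ} {f : C(X, Y)} {p : C(Y, Z)}

/-- A controlled right homotopy inverse. -/
theorem exists_right_inverse [Nonempty X] [LocallyCompactSpace Y] (hY : IsANR Y) (hdY : CoveringDimLE k Y)
    (h : IsKShapeEquivNear k f p) {ε : Z → ℝ} (hε : IsGauge ε) :
    ∃ (g : C(Y, X)) (H : (f.comp g).Homotopy (ContinuousMap.id Y)),
      IsCloseHomotopy p p (fun y => ε (p y)) H := by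
  have : Nonempty Y := (inferInstance : Nonempty X).map f
  obtain ⟨E, hE0, hE⟩ := exists_isLiftChain h (hε.div (c := 4) (by norm_num))
  have hEε : ∀ z, E (k + 1) z ≤ ε z / 4 := fun z => by
    have := hE.antitone (Nat.zero_le (k + 1)) z
    rwa [hE0] at this
  obtain ⟨ι, φ, K, ψ, D, hKc, hKd, hφ, hψ, hψρ, hD, hD0, hD1, hDε⟩ :=
    hY.exists_domination hdY p (hE (k + 1)).1
  -- With `J` a point, prisms are simplices of dimension at most `k` and the frontier is empty, so
  -- `u` imposes nothing.
  obtain ⟨g, H, hgH⟩ := hE.exists_isLiftOver (V := Euc 0) (J := univ) convex_univ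
    subsingleton_univ.isCompact (by simp) K hKc
    (fun s hs => by have := hKc s hs; simp only [finrank_euclideanSpace, Fintype.card_fin]; omega)
    hKd (ψ := fun q => ψ q.1) (u := fun _ => Classical.arbitrary X) (ρ := fun x => p (ψ x))
    (fun s hs => (hψ s hs).comp continuousOn_fst fun q hq => hq.1) (fun s hs => continuousOn_const)
    (fun s hs q hq => by simp at hq) hψρ
    (fun s hs q hq => by rw [dist_self]; exact (hE _).1.1 _)
  have hdim : ∀ s ∈ K, s.card - 1 + Module.finrank ℝ (Euc 0) ≤ k := fun s hs => by
    have := hKc s hs; simp only [finrank_euclideanSpace, Fintype.card_fin]; omega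
  have hne : ∀ y, (φ.finsupport y).Nonempty := fun y =>
    nonempty_of_mem_coordSimplex (mem_coordSimplex_finsupport φ y)
  have hlift := fun y => hgH _ (hφ y) (hne y)
  have hmem : ∀ y (v : Euc 0), ((fun a => φ a y), v) ∈ coordSimplex (φ.finsupport y) ×ˢ univ :=
    fun y v => ⟨mem_coordSimplex_finsupport φ y, mem_univ _⟩
  have hgc : Continuous fun y => g (fun a => φ a y, 0) := by
    have := continuousOn_comp_partition φ K hφ isClosed_univ fun s hs hs' => (hgH s hs hs').cont
    exact continuousOn_univ.1 (this.comp (f := fun y => (y, (0 : Euc 0))) (by fun_prop)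
      fun y _ => ⟨mem_univ _, mem_univ _⟩)
  have hHc : ContinuousOn (fun q : Y × ℝ => H ((fun a => φ a q.1, 0), q.2)) (univ ×ˢ Icc 0 1) := by
    have := continuousOn_comp_partition φ K hφ (W := Euc 0 × ℝ) (J := univ ×ˢ Icc 0 1)
      (isClosed_univ.prod isClosed_Icc) (g := fun q => H ((q.1, q.2.1), q.2.2)) fun s hs hs' =>
        ((hgH s hs hs').htpy (hdim s hs)).1.comp (by fun_prop) fun q hq =>
          ⟨⟨hq.1, hq.2.1⟩, hq.2.2⟩
    exact this.comp (f := fun q : Y × ℝ => (q.1, ((0 : Euc 0), q.2))) (by fun_prop)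
      fun q hq => ⟨mem_univ _, mem_univ _, hq.2⟩
  let Ψ : C(Y, Y) := ⟨fun y => ψ fun a => φ a y, by
    have := continuousOn_univ.1 (hD.comp (f := fun y : Y => (y, (1 : ℝ))) (by fun_prop)
      fun y _ => ⟨mem_univ _, by simp⟩)
    simpa only [Function.comp_def, hD1] using this⟩
  have hclose : ∀ y, dist (p (Ψ y)) (p y) < ε (p y) / 4 := fun y => by
    have := hDε y 1 (by simp)
    rw [hD1] at this
    exact this.trans_le (hEε _)
  obtain ⟨H₁, hH₁⟩ := exists_homotopy_of_continuousOn (f := f.comp ⟨_, hgc⟩) (g := Ψ) _ hHc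
    (fun y => ((hlift y).htpy (hdim _ (hφ y))).2.1 _ (hmem y 0))
    (fun y => ((hlift y).htpy (hdim _ (hφ y))).2.2.1 _ (hmem y 0)) (q := p) (b := p)
    (r := fun y => ε (p y)) (fun y t ht => by
      have h1 := ((hlift y).htpy (hdim _ (hφ y))).2.2.2.2 _ (hmem y 0) t ht
      rw [hE0] at h1
      have h2 := hclose y
      have h3 := hε.2 (p (Ψ y)) (p y)
      have h4 := dist_triangle (p (H ((fun a => φ a y, 0), t))) (p (Ψ y)) (p y)
      change dist (p (H ((fun a => φ a y, 0), t))) (p (Ψ y)) < ε (p (Ψ y)) / 4 at h1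
      linarith [hε.1 (p y)])
  obtain ⟨H₂, hH₂⟩ := exists_homotopy_of_continuousOn (f := ContinuousMap.id Y) (g := Ψ) D hD hD0 hD1
    (q := p) (b := p) (r := fun y => ε (p y)) (fun y t ht => by
      linarith [hDε y t ht, hEε (p y), hε.1 (p y)])
  exact ⟨_, H₁.trans H₂.symm, hH₁.trans hH₂.symm⟩

/-- A controlled right inverse is also a controlled left inverse. -/
theorem exists_left_homotopy [Nonempty X] [LocallyCompactSpace X] (hX : IsANR X) (hdX : CoveringDimLE k X)
    {ε : Z → ℝ} (hε : IsGauge ε) {E : ℕ → Z → ℝ} (hE0 : E 0 = fun z => ε z / 8)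
    (hE : IsLiftChain k f p E) (g : C(Y, X)) (H : (f.comp g).Homotopy (ContinuousMap.id Y))
    (hH : IsCloseHomotopy p p (fun y => E (k + 1) (p y)) H) :
    ∃ K : (g.comp f).Homotopy (ContinuousMap.id X),
      IsCloseHomotopy (p.comp f) (p.comp f) (fun x => ε (p (f x))) K := by
  have hEε : ∀ z, E (k + 1) z ≤ ε z / 8 := fun z => by
    have := hE.antitone (Nat.zero_le (k + 1)) z
    rwa [hE0] at this
  obtain ⟨ι, φ, K, ψ, D, hKc, hKd, hφ, hψ, hψρ, hD, hD0, hD1, hDε⟩ :=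
    hX.exists_domination hdX (p.comp f) (hE (k + 1)).1
  have hfr : frontier (Icc (0 : ℝ) 1) = {0} ∪ {1} := by
    rw [frontier_Icc zero_le_one]; rfl
  -- The homotopy from `f g f ψ` to `f ψ` given by `H` is lifted with prescribed ends `g f ψ` and
  -- `ψ`. Only `L` is kept, since the prisms may have dimension `k + 1`.
  obtain ⟨L, M, hL⟩ := hE.exists_isLiftOver (V := ℝ) (J := Icc 0 1) (convex_Icc 0 1) isCompact_Icc
    (by simp) K hKc
    (fun s hs => by have := hKc s hs; simp only [Module.finrank_self]; omega)
    hKd (ψ := fun q => H (projIcc 0 1 zero_le_one q.2, f (ψ q.1)))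
    (u := fun q => if q.2 = 0 then g (f (ψ q.1)) else ψ q.1) (ρ := fun x => p (f (ψ x)))
    (fun s hs => by
      have h1 : ContinuousOn (fun q : (ι → ℝ) × ℝ => ψ q.1) (coordSimplex s ×ˢ Icc 0 1) :=
        (hψ s hs).comp continuousOn_fst fun q hq => hq.1
      have h2 := continuous_projIcc (a := (0 : ℝ)) (b := 1) (h := zero_le_one)
      exact H.continuous.comp_continuousOn ((h2.comp continuous_snd).continuousOn.prodMk
        (f.continuous.comp_continuousOn h1)))
    (fun s hs => by
      have h1 : ∀ j : ℝ, ContinuousOn (fun q : (ι → ℝ) × ℝ => ψ q.1) (coordSimplex s ×ˢ {j}) :=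
        fun j => (hψ s hs).comp continuousOn_fst fun q hq => hq.1
      rw [hfr, prod_union]
      refine ContinuousOn.union_of_isClosed ?_ ?_ ((isClosed_coordSimplex s).prod isClosed_singleton)
        ((isClosed_coordSimplex s).prod isClosed_singleton)
      · refine ((g.comp f).continuous.comp_continuousOn (h1 0)).congr fun q hq => ?_
        have : q.2 = 0 := hq.2
        simp [this]
      · refine (h1 1).congr fun q hq => ?_
        have : q.2 = 1 := hq.2
        simp [this])
    (fun s hs q hq => by
      rw [hfr] at hq
      rcases hq.2 with h | h
      · have h : q.2 = 0 := h
        have h' : projIcc (0 : ℝ) 1 zero_le_one 0 = 0 := projIcc_left _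
        simp only [h, if_true, h', H.apply_zero]
        rfl
      · have h : q.2 = 1 := h
        have h' : projIcc (0 : ℝ) 1 zero_le_one 1 = 1 := projIcc_right _
        simp only [h, one_ne_zero, if_false, h', H.apply_one]
        rfl)
    hψρ
    (fun s hs q hq => hH _ _)
  have hne : ∀ y, (φ.finsupport y).Nonempty := fun y =>
    nonempty_of_mem_coordSimplex (mem_coordSimplex_finsupport φ y)
  have hlift := fun y => hL _ (hφ y) (hne y)
  have hmem := mem_coordSimplex_finsupport φ
  have hLc : ContinuousOn (fun q : X × ℝ => L (fun a => φ a q.1, q.2)) (univ ×ˢ Icc 0 1) :=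
    continuousOn_comp_partition φ K hφ isClosed_Icc fun s hs hs' => (hL s hs hs').cont
  let Ψ : C(X, X) := ⟨fun y => ψ fun a => φ a y, by
    have := continuousOn_univ.1 (hD.comp (f := fun y : X => (y, (1 : ℝ))) (by fun_prop)
      fun y _ => ⟨mem_univ _, by simp⟩)
    simpa only [Function.comp_def, hD1] using this⟩
  have hclose : ∀ x, dist (p (f (Ψ x))) (p (f x)) < ε (p (f x)) / 8 := fun y => by
    have := hDε y 1 (by simp)
    rw [hD1] at this
    exact this.trans_le (hEε _)
  -- The homotopy is assembled in three pieces: apply `g ∘ f` to the domination homotopy, lift over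
  -- the prisms, and return along the domination homotopy.
  obtain ⟨K₁, hK₁⟩ := exists_homotopy_of_continuousOn (f := g.comp f) (g := (g.comp f).comp Ψ)
    (fun q => g (f (D q))) ((g.comp f).continuous.comp_continuousOn hD)
    (fun x => by simp [hD0]) (fun x => by simp [hD1, Ψ]) (q := p.comp f) (b := p.comp f)
    (r := fun x => ε (p (f x))) (fun x t ht => by
      have h1 := hDε x t ht
      have h2 := hH 0 (f (D (x, t)))
      rw [H.apply_zero] at h2
      simp only [ContinuousMap.comp_apply] at h1 h2 ⊢
      have h3 := (hE (k + 1)).1.2 (p (f (D (x, t)))) (p (f x))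
      have h4 := dist_triangle (p (f (g (f (D (x, t)))))) (p (f (D (x, t)))) (p (f x))
      linarith [hEε (p (f x)), hε.1 (p (f x))])
  obtain ⟨K₂, hK₂⟩ := exists_homotopy_of_continuousOn (f := (g.comp f).comp Ψ) (g := Ψ) _ hLc
    (fun x => by
      have := (hlift x).eq (fun a => φ a x, 0) ⟨hmem x, by rw [hfr]; exact Or.inl rfl⟩
      simpa [Ψ] using this)
    (fun x => by
      have := (hlift x).eq (fun a => φ a x, 1) ⟨hmem x, by rw [hfr]; exact Or.inr rfl⟩
      simpa [Ψ] using this) (q := p.comp f) (b := p.comp f)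
    (r := fun x => ε (p (f x))) (fun x t ht => by
      have h1 := (hlift x).near (fun a => φ a x, t) ⟨hmem x, ht⟩
      rw [hE0] at h1
      have h2 := hclose x
      have h3 := hε.2 (p (f (Ψ x))) (p (f x))
      have h4 := dist_triangle (p (f (L (fun a => φ a x, t)))) (p (f (Ψ x))) (p (f x))
      change dist (p (f (L (fun a => φ a x, t)))) (p (f (Ψ x))) < ε (p (f (Ψ x))) / 8 at h1
      simp only [ContinuousMap.comp_apply]
      linarith [hε.1 (p (f x))])
  obtain ⟨K₃, hK₃⟩ := exists_homotopy_of_continuousOn (f := ContinuousMap.id X) (g := Ψ) D hD hD0 hD1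
    (q := p.comp f) (b := p.comp f) (r := fun x => ε (p (f x))) (fun x t ht => by
      have := hDε x t ht
      simp only [ContinuousMap.comp_apply] at this ⊢
      linarith [hEε (p (f x)), hε.1 (p (f x))])
  exact ⟨(K₁.trans K₂).trans K₃.symm, (hK₁.trans hK₂).trans hK₃.symm⟩

/-- Maps that are `k`-shape equivalences near the fibres have controlled homotopy inverses. -/
theorem IsKShapeEquivNear.exists_inverse [LocallyCompactSpace X] [LocallyCompactSpace Y] (hX : IsANR X) (hY : IsANR Y) (hdX : CoveringDimLE k X)
    (hdY : CoveringDimLE k Y) (h : IsKShapeEquivNear k f p) {ε : Z → ℝ} (hε : IsGauge ε) :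
    ∃ (g : C(Y, X)) (H : (f.comp g).Homotopy (ContinuousMap.id Y))
      (K : (g.comp f).Homotopy (ContinuousMap.id X)),
      IsCloseHomotopy p p (fun y => ε (p y)) H ∧
      IsCloseHomotopy (p.comp f) (p.comp f) (fun x => ε (p (f x))) K := by
  rcases isEmpty_or_nonempty Y with hYe | ⟨⟨y⟩⟩
  · have hXe : IsEmpty X := f.1.isEmpty
    exact ⟨⟨isEmptyElim, continuous_of_const fun y => isEmptyElim y⟩,
      (ContinuousMap.Homotopy.refl _).cast rfl (ContinuousMap.ext fun y => isEmptyElim y),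
      (ContinuousMap.Homotopy.refl _).cast rfl (ContinuousMap.ext fun y => isEmptyElim y),
      fun _ y => isEmptyElim y, fun _ y => isEmptyElim y⟩
  · obtain ⟨W', -, hz, hW, hst⟩ := h (p y) univ isOpen_univ (mem_univ _)
    have : Nonempty X := ⟨((isBallStep_of_isKEquivStep hW hst).vertex y hz).choose⟩
    -- The chain is fixed before `g`, so that `H` can be made as small as the last scale used in the
    -- prism lift.
    obtain ⟨E, hE0, hE⟩ := exists_isLiftChain h (hε.div (c := 8) (by norm_num))
    obtain ⟨g, H, hH⟩ := exists_right_inverse hY hdY h (hE (k + 1)).1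
    obtain ⟨K, hK⟩ := exists_left_homotopy hX hdX hε hE0 hE g H hH
    refine ⟨g, H, K, fun t y => (hH t y).trans_le ?_, hK⟩
    have := hE.antitone (Nat.zero_le (k + 1)) (p y)
    rw [hE0] at this
    simp only at this ⊢
    linarith [hε.1 (p y)]

end Inverse

/-! ### Properness, and passage from fibres to neighbourhoods -/

section Proper

/-- Neighbourhoods of a fibre of a closed map contain preimages of neighbourhoods. -/
theorem IsClosedMap.exists_preimage_subset {A B : Type*} [TopologicalSpace A] [TopologicalSpace B]
    {q : A → B} (hq : IsClosedMap q) {z : B} {O : Set A} (hO : IsOpen O) (hz : q ⁻¹' {z} ⊆ O) :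
    ∃ W : Set B, IsOpen W ∧ z ∈ W ∧ q ⁻¹' W ⊆ O := by
  refine ⟨(q '' Oᶜ)ᶜ, (hq _ hO.isClosed_compl).isOpen_compl, ?_, fun a ha => ?_⟩
  · rintro ⟨a, ha, rfl⟩
    exact ha (hz rfl)
  · by_contra h
    exact ha ⟨a, h, rfl⟩

/-- A compact neighbourhood of a compact fibre contains the preimage of a neighbourhood of the
point, so by surjectivity its image is a compact neighbourhood. -/
theorem IsProperMap.weaklyLocallyCompactSpace {A B : Type*} [TopologicalSpace A]
    [TopologicalSpace B] [LocallyCompactSpace A] {q : A → B} (hq : IsProperMap q)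
    (hs : Function.Surjective q) : WeaklyLocallyCompactSpace B := by
  refine ⟨fun z => ?_⟩
  have hfib : IsCompact (q ⁻¹' {z}) := hq.isCompact_preimage isCompact_singleton
  obtain ⟨N, hN, hsub⟩ := exists_compact_superset hfib
  obtain ⟨W, hW, hz, hWN⟩ := hq.isClosedMap.exists_preimage_subset isOpen_interior hsub
  refine ⟨q '' N, hN.image hq.continuous, Filter.mem_of_superset (hW.mem_nhds hz) fun w hw => ?_⟩
  obtain ⟨a, rfl⟩ := hs w
  exact ⟨a, interior_subset (hWN hw), rfl⟩

/-- In a locally compact metric space there is a gauge such that points that are close at its scale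
to points of a compact set lie in a compact set. -/
theorem exists_gauge_isCompact (Z : Type*) [MetricSpace Z] [WeaklyLocallyCompactSpace Z] :
    ∃ δ : Z → ℝ, IsGauge δ ∧ ∀ C : Set Z, IsCompact C → ∃ C' : Set Z, IsCompact C' ∧
      ∀ w ∈ C, ∀ z, dist w z < δ z → z ∈ C' := by
  obtain ⟨δ, hδ, hc⟩ := exists_gauge (fun (z : Z) r => IsCompact (Metric.closedBall z (2 * r)))
    (fun z r s _ hs h => h.of_isClosed_subset Metric.isClosed_closedBall
      (Metric.closedBall_subset_closedBall (by linarith)))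
    (fun z => by
      obtain ⟨N, hN, hz⟩ := exists_compact_mem_nhds z
      obtain ⟨r, hr, hrN⟩ := Metric.nhds_basis_closedBall.mem_iff.1 hz
      refine ⟨r / 4, by linarith, fun w hw => hN.of_isClosed_subset Metric.isClosed_closedBall
        ((Metric.closedBall_subset_closedBall' ?_).trans hrN)⟩
      linarith)
  -- Halving makes `dist w z < δ z / 2` imply `δ z < 2 * δ w`, so closeness measured at the unknown
  -- point `z` is controlled at `w`, and then at one of finitely many centres.
  refine ⟨fun z => δ z / 2, hδ.div (by norm_num), fun C hC => ?_⟩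
  obtain ⟨F, hF⟩ := hC.elim_nhds_subcover (fun w => Metric.ball w (δ w / 4))
    fun w _ => Metric.ball_mem_nhds w (by linarith [hδ.1 w])
  refine ⟨⋃ w ∈ F, Metric.closedBall w (2 * δ w), F.isCompact_biUnion fun w _ => hc w,
    fun w hw z hz => ?_⟩
  obtain ⟨c, hcF, hwc⟩ := mem_iUnion₂.1 (hF.2 hw)
  refine mem_iUnion₂.2 ⟨c, hcF, ?_⟩
  rw [Metric.mem_ball] at hwc
  rw [Metric.mem_closedBall]
  have h1 := hδ.2 z w
  have h2 := hδ.2 w c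
  have h3 := dist_triangle_left z c w
  rw [dist_comm z w] at h1
  simp only at hz
  linarith [hδ.1 c]

/-- A map close to a proper map is proper. -/
theorem isProperMap_of_close {A B Z : Type*} [TopologicalSpace A] [TopologicalSpace B] [T2Space B]
    [WeaklyLocallyCompactSpace B] [MetricSpace Z] {δ : Z → ℝ}
    (hδ : ∀ C : Set Z, IsCompact C → ∃ C' : Set Z, IsCompact C' ∧
      ∀ w ∈ C, ∀ z, dist w z < δ z → z ∈ C') {h : A → B} (hh : Continuous h) {q : A → Z}
    (hq : IsProperMap q) {r : B → Z} (hr : Continuous r)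
    (hclose : ∀ a, dist (r (h a)) (q a) < δ (q a)) : IsProperMap h := by
  rw [isProperMap_iff_isCompact_preimage]
  refine ⟨hh, fun C hC => ?_⟩
  obtain ⟨C', hC', hsub⟩ := hδ (r '' C) (hC.image hr)
  exact (hq.isCompact_preimage hC').of_isClosed_subset (hC.isClosed.preimage hh) fun a ha =>
    hsub _ ⟨h a, ha, rfl⟩ _ (hclose a)

theorem IsKEquivStep.mono {A : Type u} {B : Type v} [TopologicalSpace A] [TopologicalSpace B]
    {k : ℕ} {F : C(A, B)} {V₁ V₂ : Set A} {V₁' V₂' : Set B} (h : IsKEquivStep k F V₁ V₁')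
    (hV : V₂ ⊆ V₁) (hV' : V₂' ⊆ V₁') (hm : MapsTo F V₂ V₂') : IsKEquivStep k F V₂ V₂' where
  mapsTo := hm
  injective i hi α hα hn := by
    obtain ⟨b, H, hH⟩ := hn
    exact h.injective i hi α (fun s => hV (hα s)) ⟨b, H, fun q => hV' (hH q)⟩
  surjective i hi β hβ := h.surjective i hi β fun s => hV' (hβ s)
  surjective_based i hi β hβ s x hx := h.surjective_based i hi β (fun s => hV' (hβ s)) s x (hV hx)

/-- For proper maps, a `k`-shape equivalence over `Z` is one near the fibres over `Z`. -/
theorem IsKShapeEquivOver.near {X : Type u} {Y : Type v} {Z : Type w} [TopologicalSpace X]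
    [TopologicalSpace Y] [TopologicalSpace Z] (hX : IsANR X) (hY : IsANR Y) {k : ℕ} {f : C(X, Y)}
    {p : C(Y, Z)} (hf : IsProperMap f) (hp : IsProperMap p) (h : IsKShapeEquivOver k f p) :
    IsKShapeEquivNear k f p := by
  intro z W hW hz
  have hWY := hW.preimage p.continuous
  have hWX := hWY.preimage f.continuous
  have hzW : ∀ y, p y = z → p y ∈ W := fun y hy => by rw [hy]; exact hz
  -- The ambient ANRs are `X` and `Y` themselves, and `f` is its own extension.
  obtain ⟨VA, VB, hVA, hVB, hVA', hVB', hst⟩ := (h z).2.2 X Y hX hY Subtype.val Subtype.val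
    IsEmbedding.subtypeVal IsEmbedding.subtypeVal (f ⁻¹' (p ⁻¹' W)) (p ⁻¹' W) hWX hWY
    (fun x => hzW _ x.2) (fun y => hzW _ y.2) (restrictOver f p W) (fun x => rfl)
  obtain ⟨W₁, hW₁, hz₁, hs₁⟩ := (hp.comp hf).isClosedMap.exists_preimage_subset (z := z)
    (hWX.isOpenMap_subtype_val VA hVA) fun x hx => ⟨_, hVA' ⟨x, hx⟩, rfl⟩
  obtain ⟨W₂, hW₂, hz₂, hs₂⟩ := hp.isClosedMap.exists_preimage_subset (z := z)
    (hWY.isOpenMap_subtype_val VB hVB) fun y hy => ⟨_, hVB' ⟨y, hy⟩, rfl⟩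
  refine ⟨W ∩ (W₁ ∩ W₂), hW.inter (hW₁.inter hW₂), ⟨hz, hz₁, hz₂⟩, inter_subset_left,
    hst.mono (fun x hx => ?_) (fun y hy => ?_) fun x hx => hx⟩
  · obtain ⟨x', hx', he⟩ := hs₁ (show x.1 ∈ _ from hx.2.1)
    rwa [← Subtype.ext he]
  · obtain ⟨y', hy', he⟩ := hs₂ (show y.1 ∈ _ from hy.2.2)
    rwa [← Subtype.ext he]

end Proper

/-! ### The two versions of the theorem -/

theorem mainTheorem12 {X : Type u} {Y : Type v} {Z : Type w}
    [TopologicalSpace X] [LocallyCompactSpace X] [TopologicalSpace Y] [LocallyCompactSpace Y]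
    [MetricSpace Z] (hX : IsANR X) (hY : IsANR Y)
    (k : ℕ) (hdX : CoveringDimLE k X) (hdY : CoveringDimLE k Y)
    (f : C(X, Y)) (p : C(Y, Z)) (hp : IsProperMap p) (hps : Function.Surjective p) :
    -- the proper version
    (IsProperMap f → IsKShapeEquivOver k f p →
      IsProperHomotopyEquiv f ∧
      ∀ ε : C(Z, ℝ), (∀ z, 0 < ε z) →
        ∃ g : C(Y, X), IsProperMap g ∧
          (∃ H : (f.comp g).Homotopy (ContinuousMap.id Y),
            IsProperMap H ∧ IsSmallHomotopy p ε H) ∧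
          (∃ K : (g.comp f).Homotopy (ContinuousMap.id X),
            IsProperMap K ∧ IsSmallHomotopy (p.comp f) ε K)) ∧
    -- the version in which properness is dropped
    (IsKShapeEquivNear k f p →
      (∃ e : ContinuousMap.HomotopyEquiv X Y, e.toFun = f) ∧
      ∀ ε : C(Z, ℝ), (∀ z, 0 < ε z) →
        ∃ g : C(Y, X),
          (∃ H : (f.comp g).Homotopy (ContinuousMap.id Y), IsSmallHomotopy p ε H) ∧
          (∃ K : (g.comp f).Homotopy (ContinuousMap.id X), IsSmallHomotopy (p.comp f) ε K)) := by
  have hmX := hX.1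
  have hmY := hY.1
  constructor
  · intro hf hover
    have hnear := hover.near hX hY hf hp
    have : WeaklyLocallyCompactSpace Z := hp.weaklyLocallyCompactSpace hps
    obtain ⟨δ, hδ, hδc⟩ := exists_gauge_isCompact Z
    have key : ∀ ε : C(Z, ℝ), (∀ z, 0 < ε z) → ∃ g : C(Y, X), IsProperMap g ∧
        (∃ H : (f.comp g).Homotopy (ContinuousMap.id Y),
          IsProperMap H ∧ IsSmallHomotopy p ε H) ∧
        (∃ K : (g.comp f).Homotopy (ContinuousMap.id X),
          IsProperMap K ∧ IsSmallHomotopy (p.comp f) ε K) := by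
      intro ε hε
      obtain ⟨η, hη, hηε⟩ := exists_gauge_le ε.continuous hε
      -- One gauge serves both purposes: `η` gives the required smallness and `δ` gives properness.
      obtain ⟨g, H, K, hH, hK⟩ := hnear.exists_inverse hX hY hdX hdY (hη.min hδ)
      have hHδ : ∀ t y, dist (p (H (t, y))) (p y) < δ (p y) := fun t y =>
        (hH t y).trans_le (min_le_right _ _)
      have hKδ : ∀ t x, dist (p (f (K (t, x)))) (p (f x)) < δ (p (f x)) := fun t x =>
        (hK t x).trans_le (min_le_right _ _)
      refine ⟨g, ?_, ⟨H, ?_, fun t y => ?_⟩, ⟨K, ?_, fun t x => ?_⟩⟩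
      -- At time 0 the homotopy `H` is `f ∘ g`, so `p ∘ f ∘ g` is close to the proper map `p`.
      · refine isProperMap_of_close hδc g.continuous hp (p.comp f).continuous fun y => ?_
        have := hHδ 0 y
        rwa [H.apply_zero] at this
      · exact isProperMap_of_close hδc H.continuous (hp.comp isProperMap_snd_of_compactSpace)
          p.continuous fun q => hHδ q.1 q.2
      · exact (hH t y).trans_le ((min_le_left _ _).trans (hηε _))
      · exact isProperMap_of_close hδc K.continuous
          ((hp.comp hf).comp isProperMap_snd_of_compactSpace) (p.comp f).continuous
          fun q => hKδ q.1 q.2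
      · exact (hK t x).trans_le ((min_le_left _ _).trans (hηε _))
    refine ⟨⟨hf, ?_⟩, key⟩
    obtain ⟨g, hg, ⟨H, hH, -⟩, ⟨K, hK, -⟩⟩ := key (ContinuousMap.const Z 1) fun _ => one_pos
    exact ⟨g, hg, ⟨H, hH⟩, ⟨K, hK⟩⟩
  · intro hnear
    have key : ∀ ε : C(Z, ℝ), (∀ z, 0 < ε z) → ∃ g : C(Y, X),
        (∃ H : (f.comp g).Homotopy (ContinuousMap.id Y), IsSmallHomotopy p ε H) ∧
        (∃ K : (g.comp f).Homotopy (ContinuousMap.id X), IsSmallHomotopy (p.comp f) ε K) := by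
      intro ε hε
      obtain ⟨η, hη, hηε⟩ := exists_gauge_le ε.continuous hε
      obtain ⟨g, H, K, hH, hK⟩ := hnear.exists_inverse hX hY hdX hdY hη
      exact ⟨g, ⟨H, fun t y => (hH t y).trans_le (hηε _)⟩, ⟨K, fun t x => (hK t x).trans_le (hηε _)⟩⟩
    refine ⟨?_, key⟩
    obtain ⟨g, ⟨H, -⟩, ⟨K, -⟩⟩ := key (ContinuousMap.const Z 1) fun _ => one_pos
    exact ⟨⟨f, g, ⟨K⟩, ⟨H⟩⟩, rfl⟩
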